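/- Let $\mathfrak U=\langle S;P_1,\dots,P_r;L_1,\dots,L_r\rangle$, where $S\subseteq[0,\infty)$ is a countable set, $P_1,\dots,P_r$ are finitely many relation symbols of arities $k_i\ge 1$, and each $L_i$ is a subgroup of $\mathrm{Sym}(\{1,\dots,k_i\})$. Let $L_{\mathfrak U}$ be the relational language consisting of $P_1,\dots,P_r$ and of a binary symbol $E_s$ for each $s\in S$. A $\mathfrak U$-structure is an $L_{\mathfrak U}$-structure $\mathbf X$ such that 1. $P_i^{\mathbf X}(x_{\vartheta(1)},\dots,x_{\vartheta(k_i)})\Leftrightarrow P_i^{\mathbf X}(x_1,\dots,x_{k_i})$ for all $i$, all $\vartheta\in L_i$ and all $x_1,\dots,x_{k_i}\in\mathbf X$; 2. if $P_i^{\mathbf X}(x_1,\dots,x_{k_i})$, then $x_1,\dots,x_{k_i}$ are distinct; 3. each $E_s^{\mathbf X}$ is an equivalence relation, and $E_s^{\mathbf X}\subseteq E_t^{\mathbf X}$ whenever $s<t$ in $S$; 4. if $S\neq\emptyset$, then for all $x\ne y$ in $\mathbf X$ there is a maximal $s\in S$ with $\neg(x\,E_s^{\mathbf X}\,y)$. Let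 $\mathbf U$ be the Fraïssé limit of the class of all finite $\mathfrak U$-structures, i.e. the countable ultrahomogeneous $L_{\mathfrak U}$-structure, unique up to isomorphism, whose finitely generated substructures are, up to isomorphism, exactly the finite $\mathfrak U$-structures. Give $\mathrm{Aut}(\mathbf U)$ the topology of pointwise convergence, with $\mathbf U$ discrete. For a group $\Gamma$ let $\mathsf{Rep}(\Gamma,\mathbf U)$ be the space of all homomorphisms $\Gamma\to\mathrm{Aut}(\mathbf U)$, with the topology inherited from the product $\mathrm{Aut}(\mathbf U)^\Gamma$. The group $\mathrm{Aut}(\mathbf U)$ acts on it by conjugation, $(g\cdot\pi)(\gamma)=g\,\pi(\gamma)\,g^{-1}$, and $\pi$ is called generic if its orbit under this action is comeagre in $\mathsf{Rep}(\Gamma,\mathbf U)$. **Proposition.** Let $\Delta$ and $\Lambda$ be finitely generated subgroups of an abelian group $\Gamma$ with $\Gamma=\langle\Delta,\Lambda\rangle$. Then there is a generic element $\pi$ of $\mathsf{Rep}(\Gamma,\mathbf U)$ whose restriction $\pi|\Delta$ is generic in $\mathsf{Rep}(\Delta,\mathbf U)$. -/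

import Mathlib

open scoped FirstOrder

/-- A tuple `⟨S; P₁, …, P_r; L₁, …, L_r⟩`: a countable set `S` of nonnegative reals, finitely many
relation symbols `P i` of arity `arity i ≥ 1`, and for each of them a group `L i` of permutations
of the argument places. -/
structure UTuple where
  S : Set ℝ
  S_countable : S.Countable
  S_nonneg : S ⊆ Set.Ici 0
  r : ℕ
  arity : Fin r → ℕ
  arity_pos : ∀ i, 0 < arity i
  L : ∀ i, Subgroup (Equiv.Perm (Fin (arity i)))

namespace UTuple

/-- The relation symbols of the language of `𝔘`: binary symbols `E s`, `s ∈ S`, and the `P i`. -/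
inductive Rel (𝔘 : UTuple) : ℕ → Type
  | E (s : 𝔘.S) : Rel 𝔘 2
  | P (i : Fin 𝔘.r) : Rel 𝔘 (𝔘.arity i)

/-- The relational language of `𝔘`. -/
def lang (𝔘 : UTuple) : FirstOrder.Language.{0, 0} := ⟨fun _ => Empty, 𝔘.Rel⟩

instance (𝔘 : UTuple) : 𝔘.lang.IsRelational := fun _ => inferInstanceAs (IsEmpty Empty)

instance (𝔘 : UTuple) : Countable (Σ n, 𝔘.lang.Functions n) :=
  have : ∀ n, IsEmpty (𝔘.lang.Functions n) := fun _ => inferInstanceAs (IsEmpty Empty)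
  inferInstance

section

variable (𝔘 : UTuple) {X : Type*} [𝔘.lang.Structure X]

/-- The interpretation of the symbol `E s` in the structure `X`. -/
def relE (s : 𝔘.S) (x y : X) : Prop :=
  FirstOrder.Language.Structure.RelMap (L := 𝔘.lang) (Rel.E s : 𝔘.Rel 2) ![x, y]

/-- The interpretation of the symbol `P i` in the structure `X`. -/
def relP (i : Fin 𝔘.r) (x : Fin (𝔘.arity i) → X) : Prop :=
  FirstOrder.Language.Structure.RelMap (L := 𝔘.lang) (Rel.P i : 𝔘.Rel (𝔘.arity i)) x

variable (X) in
/-- `X` is a `𝔘`-structure. If `S` is empty there are no relations `E s`, and the last condition is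
void, so that one obtains the plain (symmetric, irreflexive) relational structures. -/
structure IsUStructure : Prop where
  symm : ∀ i, ∀ ϑ ∈ 𝔘.L i, ∀ x : Fin (𝔘.arity i) → X, 𝔘.relP i (x ∘ ϑ) ↔ 𝔘.relP i x
  distinct : ∀ i, ∀ x : Fin (𝔘.arity i) → X, 𝔘.relP i x → Function.Injective x
  equivalence : ∀ s, Equivalence (fun x y : X => 𝔘.relE s x y)
  nested : ∀ s t, s < t → ∀ x y : X, 𝔘.relE s x y → 𝔘.relE t x y
  exists_max : 𝔘.S.Nonempty → ∀ x y : X, x ≠ y → ∃ s, IsGreatest {t | ¬ 𝔘.relE t x y} s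

end

/-- The class of all finite `𝔘`-structures. -/
def finiteClass (𝔘 : UTuple) : Set (CategoryTheory.Bundled.{0} 𝔘.lang.Structure) :=
  {X | Finite X ∧ 𝔘.IsUStructure X}

/-! ### Existence of the Fraïssé limit

An explicit countable ultrahomogeneous structure whose age is the class of finite `𝔘`-structures:
the ultrametric space of finitely supported functions, with generic relations `P i`. -/

namespace Model

/-- The index set of the model: `S`, or a singleton if `S` is empty. -/
def T (𝔘 : UTuple) : Set ℝ := {t | t ∈ 𝔘.S ∨ (𝔘.S = ∅ ∧ t = 0)}

lemma T_countable (𝔘 : UTuple) : (T 𝔘).Countable :=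
  (𝔘.S_countable.union (Set.countable_singleton 0)).mono fun _ ht => ht.imp id And.right

lemma T_nonempty (𝔘 : UTuple) : Nonempty (T 𝔘) := by
  rcases 𝔘.S.eq_empty_or_nonempty with h | ⟨s, hs⟩
  · exact ⟨⟨0, Or.inr ⟨h, rfl⟩⟩⟩
  · exact ⟨⟨s, Or.inl hs⟩⟩

instance (𝔘 : UTuple) : Countable (T 𝔘) := (T_countable 𝔘).to_subtype

/-- The points of the model. -/
def Pt (𝔘 : UTuple) : Type := T 𝔘 →₀ ℕ

instance (𝔘 : UTuple) : Countable (Pt 𝔘) := inferInstanceAs (Countable (T 𝔘 →₀ ℕ))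

/-- The finitely supported function underlying a point. -/
def toF {𝔘 : UTuple} (x : Pt 𝔘) : T 𝔘 →₀ ℕ := x

/-- The value of a point at an index. -/
def val {𝔘 : UTuple} (x : Pt 𝔘) (t : T 𝔘) : ℕ := toF x t

lemma val_ext {𝔘 : UTuple} {x y : Pt 𝔘} (h : ∀ t, val x t = val y t) : x = y :=
  Finsupp.ext (f := toF x) (g := toF y) h

lemma finite_ne {𝔘 : UTuple} (x y : Pt 𝔘) : {t | val x t ≠ val y t}.Finite := by
  classical
  refine ((toF x).support ∪ (toF y).support).finite_toSet.subset fun t ht => ?_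
  by_contra hc
  simp only [Finset.coe_union, Set.mem_union, Finset.mem_coe, Finsupp.mem_support_iff, not_or,
    not_not] at hc
  exact ht (hc.1.trans hc.2.symm)

/-- The largest value of a point. -/
def rank {𝔘 : UTuple} (x : Pt 𝔘) : ℕ := (toF x).support.sup ⇑(toF x)

lemma val_le_rank {𝔘 : UTuple} (x : Pt 𝔘) (t : T 𝔘) : val x t ≤ rank x := by
  by_cases h : val x t = 0
  · omega
  · exact Finset.le_sup (f := ⇑(toF x)) (Finsupp.mem_support_iff.2 h)

lemma exists_update {𝔘 : UTuple} (x : Pt 𝔘) (t : T 𝔘) (k : ℕ) (hk : rank x ≤ k) :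
    ∃ y : Pt 𝔘, val y t = k ∧ (∀ u, u ≠ t → val y u = val x u) ∧ rank y = k := by
  classical
  let y : Pt 𝔘 := ((toF x).update t k : T 𝔘 →₀ ℕ)
  have h1 : val y t = k := by
    change ((toF x).update t k) t = k
    simp
  have h2 : ∀ u, u ≠ t → val y u = val x u := fun u hu => by
    change ((toF x).update t k) u = toF x u
    simp [hu]
  refine ⟨y, h1, h2, le_antisymm ?_ (h1 ▸ val_le_rank y t)⟩
  refine Finset.sup_le fun u _ => ?_
  change val y u ≤ k
  by_cases hu : u = t
  · rw [hu, h1]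
  · rw [h2 u hu]; exact (val_le_rank x u).trans hk

/-- Finite relational patterns; `none` stands for an element of largest rank. -/
abbrev Pattern (𝔘 : UTuple) : Type := Finset (Σ i : Fin 𝔘.r, Fin (𝔘.arity i) → Option (Pt 𝔘))

lemma exists_code (𝔘 : UTuple) :
    ∃ c : ℕ → Pattern 𝔘, ∀ R N, ∃ k, N ≤ k ∧ c k = R := by
  have : Countable (Option (Pt 𝔘)) := inferInstance
  obtain ⟨g, hg⟩ := exists_surjective_nat (Pattern 𝔘)
  refine ⟨fun k => g (Nat.unpair k).1, fun R N => ?_⟩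
  obtain ⟨n, hn⟩ := hg R
  exact ⟨Nat.pair n N, Nat.right_le_pair _ _, by simp [hn]⟩

/-- An enumeration of the patterns in which each of them occurs infinitely often. -/
noncomputable def code (𝔘 : UTuple) : ℕ → Pattern 𝔘 := (exists_code 𝔘).choose

lemma code_spec (𝔘 : UTuple) (R : Pattern 𝔘) (N : ℕ) : ∃ k, N ≤ k ∧ code 𝔘 k = R :=
  (exists_code 𝔘).choose_spec R N

/-- The largest rank in a tuple. -/
def top {𝔘 : UTuple} {n : ℕ} (y : Fin n → Pt 𝔘) : ℕ := Finset.univ.sup fun j => rank (y j)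

open Classical in
/-- Replace the entries of largest rank by `none`. -/
noncomputable def mask {𝔘 : UTuple} {n : ℕ} (y : Fin n → Pt 𝔘) (j : Fin n) : Option (Pt 𝔘) :=
  if rank (y j) = top y then none else some (y j)

lemma rank_le_top {𝔘 : UTuple} {n : ℕ} (y : Fin n → Pt 𝔘) (j : Fin n) : rank (y j) ≤ top y :=
  Finset.le_sup (f := fun j => rank (y j)) (Finset.mem_univ j)

lemma top_comp {𝔘 : UTuple} {n : ℕ} (y : Fin n → Pt 𝔘) (ϑ : Equiv.Perm (Fin n)) :
    top (y ∘ ϑ) = top y := by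
  refine le_antisymm (Finset.sup_le fun j _ => rank_le_top y (ϑ j)) (Finset.sup_le fun j _ => ?_)
  simpa using rank_le_top (y ∘ ϑ) (ϑ.symm j)

lemma mask_comp {𝔘 : UTuple} {n : ℕ} (y : Fin n → Pt 𝔘) (ϑ : Equiv.Perm (Fin n)) :
    mask (y ∘ ϑ) = mask y ∘ ϑ := by
  funext j
  simp [mask, top_comp]

/-- The interpretation of the symbols in the model. -/
def interp (𝔘 : UTuple) : ∀ {n : ℕ}, 𝔘.Rel n → (Fin n → Pt 𝔘) → Prop
  | _, .E s, v => ∀ t : T 𝔘, (s : ℝ) ≤ t → val (v 0) t = val (v 1) t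
  | _, .P i, v => Function.Injective v ∧
      ∃ ϑ ∈ 𝔘.L i, (⟨i, mask v ∘ ϑ⟩ : Σ i, Fin (𝔘.arity i) → Option (Pt 𝔘)) ∈ code 𝔘 (top v)

instance (𝔘 : UTuple) : 𝔘.lang.Structure (Pt 𝔘) where
  funMap f := Empty.elim f
  RelMap R v := interp 𝔘 R v

lemma relE_iff {𝔘 : UTuple} (s : 𝔘.S) (x y : Pt 𝔘) :
    𝔘.relE s x y ↔ ∀ t : T 𝔘, (s : ℝ) ≤ t → val x t = val y t := Iff.rfl

lemma relP_iff {𝔘 : UTuple} (i : Fin 𝔘.r) (v : Fin (𝔘.arity i) → Pt 𝔘) :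
    𝔘.relP i v ↔ Function.Injective v ∧
      ∃ ϑ ∈ 𝔘.L i, (⟨i, mask v ∘ ϑ⟩ : Σ i, Fin (𝔘.arity i) → Option (Pt 𝔘)) ∈ code 𝔘 (top v) :=
  Iff.rfl

lemma isUStructure (𝔘 : UTuple) : 𝔘.IsUStructure (Pt 𝔘) where
  symm i ϑ hϑ x := by
    rw [relP_iff, relP_iff, top_comp, mask_comp]
    refine and_congr (Equiv.injective_comp ϑ x) ⟨?_, ?_⟩
    · rintro ⟨η, hη, h⟩
      exact ⟨ϑ * η, mul_mem hϑ hη, h⟩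
    · rintro ⟨η, hη, h⟩
      refine ⟨ϑ⁻¹ * η, mul_mem (inv_mem hϑ) hη, ?_⟩
      have : (mask x ∘ ϑ) ∘ ⇑(ϑ⁻¹ * η) = mask x ∘ η := by
        funext j; simp
      rwa [this]
  distinct i x h := h.1
  equivalence s :=
    ⟨fun x t _ => rfl, fun h t ht => (h t ht).symm, fun h h' t ht => (h t ht).trans (h' t ht)⟩
  nested s t hst x y h u hu := h u (le_trans (le_of_lt hst) hu)
  exists_max hS x y hxy := by
    have hne : (finite_ne x y).toFinset.Nonempty := by
      by_contra hc
      refine hxy (val_ext fun t => ?_)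
      by_contra ht
      exact hc ⟨t, by simpa using ht⟩
    obtain ⟨m, hm, hmax⟩ := Finset.exists_max_image _ (fun t : T 𝔘 => (t : ℝ)) hne
    simp only [Set.Finite.mem_toFinset, Set.mem_ofPred_eq] at hm hmax
    have hmS : (m : ℝ) ∈ 𝔘.S := m.2.resolve_right fun h => hS.ne_empty h.1
    refine ⟨⟨m, hmS⟩, fun h => hm (h m le_rfl), fun t ht => ?_⟩
    simp only [Set.mem_ofPred_eq, relE_iff, not_forall] at ht
    obtain ⟨u, hu, hne⟩ := ht
    exact hu.trans (hmax u hne)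

/-- `f` is an embedding of the substructure of `X` with universe `A` into the model. -/
structure PEmb {𝔘 : UTuple} {X : Type*} [𝔘.lang.Structure X] (f : X → Pt 𝔘) (A : Set X) :
    Prop where
  inj : Set.InjOn f A
  relE : ∀ s, ∀ x ∈ A, ∀ y ∈ A, 𝔘.relE s (f x) (f y) ↔ 𝔘.relE s x y
  relP : ∀ i, ∀ v : Fin (𝔘.arity i) → X, (∀ j, v j ∈ A) → (𝔘.relP i (f ∘ v) ↔ 𝔘.relP i v)

/-- The metric part of the one-point extension property. -/
lemma exists_point {𝔘 : UTuple} {X : Type*} [𝔘.lang.Structure X] (hX : 𝔘.IsUStructure X)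
    (f : X → Pt 𝔘) (A : Finset X) (hf : PEmb f (A : Set X)) (b : X) (hb : b ∉ A) :
    ∃ N : ℕ, ∀ k, N ≤ k → ∃ x : Pt 𝔘, rank x = k ∧ (∀ a ∈ A, rank (f a) < k) ∧
      ∀ a ∈ A, ∀ s, 𝔘.relE s x (f a) ↔ 𝔘.relE s b a := by
  classical
  rcases A.eq_empty_or_nonempty with rfl | hA
  · obtain ⟨t⟩ := T_nonempty 𝔘
    refine ⟨rank (0 : T 𝔘 →₀ ℕ), fun k hk => ?_⟩
    obtain ⟨x, -, -, hx⟩ := exists_update (𝔘 := 𝔘) (0 : T 𝔘 →₀ ℕ) t k hk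
    exact ⟨x, hx, by simp, by simp⟩
  · have hne : ∀ a ∈ A, b ≠ a := fun a ha h => hb (h ▸ ha)
    have hex : ∃ δ : X → T 𝔘, ∀ a ∈ A, ∀ s : 𝔘.S, 𝔘.relE s b a ↔ (δ a : ℝ) < s := by
      have : ∀ a, ∃ d : T 𝔘, a ∈ A → ∀ s : 𝔘.S, 𝔘.relE s b a ↔ (d : ℝ) < s := by
        intro a
        by_cases ha : a ∈ A
        · rcases 𝔘.S.eq_empty_or_nonempty with h | h
          · refine ⟨(T_nonempty 𝔘).some, fun _ s => ?_⟩
            have := s.2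
            simp [h] at this
          · obtain ⟨m, hm, hmax⟩ := hX.exists_max h b a (hne a ha)
            refine ⟨⟨m, Or.inl m.2⟩, fun _ s => ⟨fun hs => ?_, fun hs => ?_⟩⟩
            · by_contra hc
              rcases (not_lt.1 hc).lt_or_eq with h1 | h1
              · exact hm (hX.nested s m h1 _ _ hs)
              · exact hm ((Subtype.ext h1 : s = m) ▸ hs)
            · by_contra hc
              exact absurd (hmax hc) (not_le.2 hs)
        · exact ⟨(T_nonempty 𝔘).some, fun h => absurd h ha⟩
      choose δ hδ using this
      exact ⟨δ, hδ⟩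
    obtain ⟨δ, hδ⟩ := hex
    obtain ⟨a₀, ha₀, hmin⟩ := Finset.exists_min_image A (fun a => (δ a : ℝ)) hA
    refine ⟨A.sup (fun a => rank (f a)) + 1, fun k hk => ?_⟩
    have hlt : ∀ a ∈ A, rank (f a) < k := fun a ha =>
      lt_of_le_of_lt (Finset.le_sup (f := fun a => rank (f a)) ha) hk
    obtain ⟨x, hx1, hx2, hx3⟩ := exists_update (f a₀) (δ a₀) k (hlt a₀ ha₀).le
    refine ⟨x, hx3, hlt, fun a ha s => ?_⟩
    have key : 𝔘.relE s x (f a) ↔ (δ a₀ : ℝ) < s ∧ 𝔘.relE s (f a₀) (f a) := by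
      constructor
      · intro h
        have h1 : (δ a₀ : ℝ) < s := by
          by_contra hc
          have h2 := h (δ a₀) (not_lt.1 hc)
          have h3 : k = val (f a) (δ a₀) := hx1.symm.trans h2
          have h4 := val_le_rank (f a) (δ a₀)
          have h5 := hlt a ha
          omega
        refine ⟨h1, fun t ht => ?_⟩
        have h2 : t ≠ δ a₀ := fun h3 => absurd (h3 ▸ ht) (not_le.2 h1)
        exact (hx2 t h2).symm.trans (h t ht)
      · rintro ⟨h1, h⟩ t ht
        have h2 : t ≠ δ a₀ := fun h3 => absurd (h3 ▸ ht) (not_le.2 h1)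
        exact (hx2 t h2).trans (h t ht)
    rw [key, hf.relE s a₀ ha₀ a ha, ← hδ a₀ ha₀]
    have e := hX.equivalence s
    constructor
    · rintro ⟨h1, h2⟩
      exact e.trans h1 h2
    · intro h
      have h1 : 𝔘.relE s b a₀ := (hδ a₀ ha₀ s).2 (lt_of_le_of_lt (hmin a ha) ((hδ a ha s).1 h))
      exact ⟨h1, e.trans (e.symm h1) h⟩

/-- The one-point extension property of the model. -/
lemma extend {𝔘 : UTuple} {X : Type*} [𝔘.lang.Structure X] (hX : 𝔘.IsUStructure X)
    (f : X → Pt 𝔘) (A : Finset X) (hf : PEmb f (A : Set X)) (b : X) (hb : b ∉ A) :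
    ∃ g : X → Pt 𝔘, (∀ a ∈ A, g a = f a) ∧ PEmb g (insert b (A : Set X)) := by
  classical
  obtain ⟨N, hN⟩ := exists_point hX f A hf b hb
  let enc : X → Option (Pt 𝔘) := fun z => if z = b then none else some (f z)
  have enc_inj : Set.InjOn enc (insert b (A : Set X)) := by
    rintro y hy z hz hyz
    by_cases h1 : y = b <;> by_cases h2 : z = b
    · rw [h1, h2]
    · simp [enc, h1, h2] at hyz
    · simp [enc, h1, h2] at hyz
    · simp only [enc, h1, h2, if_false, Option.some.injEq] at hyz
      exact hf.inj (hy.resolve_left h1) (hz.resolve_left h2) hyz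
  have hfin : {p : Σ i : Fin 𝔘.r, Fin (𝔘.arity i) → Option (Pt 𝔘) |
      ∃ v : Fin (𝔘.arity p.1) → X, (∀ j, v j ∈ insert b (A : Set X)) ∧ 𝔘.relP p.1 v ∧
        p.2 = enc ∘ v}.Finite := by
    have hA : (insert b (A : Set X)).Finite := A.finite_toSet.insert b
    have : Finite (insert b (A : Set X) : Set X) := hA
    refine (Set.finite_range (fun q : Σ i : Fin 𝔘.r, Fin (𝔘.arity i) →
      (insert b (A : Set X) : Set X) => (⟨q.1, fun j => enc (q.2 j)⟩ :
        Σ i : Fin 𝔘.r, Fin (𝔘.arity i) → Option (Pt 𝔘)))).subset ?_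
    rintro ⟨i, w⟩ ⟨v, hv, -, hw⟩
    change w = enc ∘ v at hw
    exact ⟨⟨i, fun j => ⟨v j, hv j⟩⟩, by rw [hw]; rfl⟩
  obtain ⟨k, hk, hcode⟩ := code_spec 𝔘 hfin.toFinset N
  obtain ⟨x, hx, hlt, hE⟩ := hN k hk
  let g : X → Pt 𝔘 := Function.update f b x
  have gb : g b = x := by simp [g]
  have ga : ∀ a ∈ A, g a = f a := fun a ha => by
    have : a ≠ b := fun h => hb (h ▸ ha)
    simp [g, this]
  have hrank : ∀ a ∈ A, rank (g a) < k := fun a ha => by rw [ga a ha]; exact hlt a ha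
  have ginj : Set.InjOn g (insert b (A : Set X)) := by
    have hxa : ∀ a ∈ A, g b ≠ g a := fun a ha h => by
      have := hrank a ha
      rw [← h, gb, hx] at this
      exact lt_irrefl _ this
    rintro y (rfl | hy) z (rfl | hz) h
    · rfl
    · exact absurd h (hxa z hz)
    · exact absurd h.symm (hxa y hy)
    · exact hf.inj hy hz (by rwa [ga y hy, ga z hz] at h)
  refine ⟨g, ga, ginj, ?_, ?_⟩
  · intro s y hy z hz
    have e := hX.equivalence s
    have e' := (isUStructure 𝔘).equivalence s
    rcases hy with rfl | hy <;> rcases hz with rfl | hz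
    · exact iff_of_true (e'.refl _) (e.refl _)
    · rw [gb, ga z hz]
      exact hE z hz s
    · rw [gb, ga y hy]
      exact ⟨fun h => e.symm ((hE y hy s).1 (e'.symm h)),
        fun h => e'.symm ((hE y hy s).2 (e.symm h))⟩
    · rw [ga y hy, ga z hz]
      exact hf.relE s y hy z hz
  · intro i v hv
    by_cases hbv : ∃ j, v j = b
    · obtain ⟨j₀, hj₀⟩ := hbv
      have htop : top (g ∘ v) = k := by
        refine le_antisymm (Finset.sup_le fun j _ => ?_) ?_
        · rcases hv j with h | h
          · simp [h, gb, hx]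
          · exact (hrank _ h).le
        · have := rank_le_top (g ∘ v) j₀
          simpa [hj₀, gb, hx] using this
      have hmask : mask (g ∘ v) = enc ∘ v := by
        funext j
        simp only [mask, htop, Function.comp_apply, enc]
        rcases hv j with h | h
        · simp [h, gb, hx]
        · have h1 : v j ≠ b := fun h2 => hb (h2 ▸ h)
          simp [h1, (hlt _ h).ne, ga _ h]
      have hmem : ∀ ϑ ∈ 𝔘.L i, ((⟨i, mask (g ∘ v) ∘ ϑ⟩ :
          Σ i, Fin (𝔘.arity i) → Option (Pt 𝔘)) ∈ code 𝔘 (top (g ∘ v)) ↔ 𝔘.relP i v) := by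
        intro ϑ hϑ
        rw [htop, hcode, Set.Finite.mem_toFinset, hmask]
        constructor
        · rintro ⟨w, hw, hP, heq⟩
          have : w = v ∘ ϑ := funext fun j =>
            (enc_inj (hv (ϑ j)) (hw j) (congrFun heq j)).symm
          rw [this] at hP
          exact (hX.symm i ϑ hϑ v).1 hP
        · intro hP
          exact ⟨v ∘ ϑ, fun j => hv _, (hX.symm i ϑ hϑ v).2 hP, rfl⟩
      rw [relP_iff]
      constructor
      · rintro ⟨-, ϑ, hϑ, h⟩
        exact (hmem ϑ hϑ).1 h
      · intro h
        refine ⟨fun j j' hjj => hX.distinct i v h (ginj (hv j) (hv j') hjj), 1, one_mem _, ?_⟩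
        exact (hmem 1 (one_mem _)).2 h
    · have hvA : ∀ j, v j ∈ (A : Set X) := fun j => (hv j).resolve_left fun h => hbv ⟨j, h⟩
      have : g ∘ v = f ∘ v := funext fun j => ga _ (hvA j)
      rw [this]
      exact hf.relP i v hvA

/-- Partial embeddings extend to larger finite sets. -/
lemma extend_finset {𝔘 : UTuple} {X : Type*} [𝔘.lang.Structure X] (hX : 𝔘.IsUStructure X)
    (f : X → Pt 𝔘) (A : Finset X) (hf : PEmb f (A : Set X)) (B : Finset X) :
    ∃ g : X → Pt 𝔘, (∀ a ∈ A, g a = f a) ∧ PEmb g ((A : Set X) ∪ B) := by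
  classical
  induction B using Finset.induction_on with
  | empty => exact ⟨f, fun _ _ => rfl, by simpa using hf⟩
  | insert b B _ ih =>
    obtain ⟨g, hg, hgB⟩ := ih
    by_cases hb : b ∈ A ∪ B
    · refine ⟨g, hg, ?_⟩
      have : (A : Set X) ∪ ↑(insert b B) = (A : Set X) ∪ (B : Set X) := by
        ext z
        simp only [Finset.mem_union] at hb
        simp only [Finset.coe_insert, Set.mem_union, Set.mem_insert_iff, Finset.mem_coe]
        constructor
        · rintro (h | rfl | h)
          exacts [Or.inl h, hb, Or.inr h]
        · rintro (h | h)
          exacts [Or.inl h, Or.inr (Or.inr h)]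
      rwa [this]
    · obtain ⟨g', hg', h⟩ := extend hX g (A ∪ B) (by rwa [Finset.coe_union]) b hb
      refine ⟨g', fun a ha => (hg' a (Finset.mem_union_left _ ha)).trans (hg a ha), ?_⟩
      have : (A : Set X) ∪ ↑(insert b B) = insert b (↑(A ∪ B) : Set X) := by
        ext z
        simp only [Finset.coe_insert, Finset.coe_union, Set.mem_union, Set.mem_insert_iff]
        tauto
      rwa [this]

lemma relE_map {𝔘 : UTuple} {X Y : Type*} [𝔘.lang.Structure X] [𝔘.lang.Structure Y]
    (f : X ↪[𝔘.lang] Y) (s : 𝔘.S) (x y : X) : 𝔘.relE s (f x) (f y) ↔ 𝔘.relE s x y := by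
  have h := f.map_rel (Rel.E s : 𝔘.Rel 2) ![x, y]
  have e : f ∘ ![x, y] = ![f x, f y] := by
    funext j
    fin_cases j <;> rfl
  rw [e] at h
  exact h

lemma relP_map {𝔘 : UTuple} {X Y : Type*} [𝔘.lang.Structure X] [𝔘.lang.Structure Y]
    (f : X ↪[𝔘.lang] Y) (i : Fin 𝔘.r) (v : Fin (𝔘.arity i) → X) :
    𝔘.relP i (f ∘ v) ↔ 𝔘.relP i v :=
  f.map_rel (Rel.P i : 𝔘.Rel (𝔘.arity i)) v

/-- An injective map that respects the relations is an embedding. -/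
def mkEmbedding {𝔘 : UTuple} {X Y : Type*} [𝔘.lang.Structure X] [𝔘.lang.Structure Y]
    (f : X → Y) (hf : Function.Injective f)
    (hE : ∀ s x y, 𝔘.relE s (f x) (f y) ↔ 𝔘.relE s x y)
    (hP : ∀ i v, 𝔘.relP i (f ∘ v) ↔ 𝔘.relP i v) : X ↪[𝔘.lang] Y where
  toFun := f
  inj' := hf
  map_fun' := fun {_} F => Empty.elim F
  map_rel' := by
    intro n R v
    change 𝔘.Rel n at R
    cases R with
    | E s =>
      have e : v = ![v 0, v 1] := by
        funext j
        fin_cases j <;> rfl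
      have e' : f ∘ v = ![f (v 0), f (v 1)] := by
        funext j
        fin_cases j <;> rfl
      change FirstOrder.Language.Structure.RelMap (L := 𝔘.lang) (Rel.E s : 𝔘.Rel 2) (f ∘ v) ↔ _
      rw [e']
      conv_rhs => rw [e]
      exact hE s (v 0) (v 1)
    | P i => exact hP i v

/-- Being a `𝔘`-structure is inherited by embedded structures. -/
lemma isUStructure_of_embedding {𝔘 : UTuple} {X Y : Type*} [𝔘.lang.Structure X]
    [𝔘.lang.Structure Y] (hY : 𝔘.IsUStructure Y) (f : X ↪[𝔘.lang] Y) : 𝔘.IsUStructure X where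
  symm i ϑ hϑ x := by
    rw [← relP_map f i, ← relP_map f i x]
    exact hY.symm i ϑ hϑ (f ∘ x)
  distinct i x h := ((hY.distinct i _ ((relP_map f i x).2 h))).of_comp
  equivalence s := by
    have e := hY.equivalence s
    refine ⟨fun x => ?_, fun {x y} h => ?_, fun {x y z} h h' => ?_⟩
    · exact (relE_map f s x x).1 (e.refl _)
    · exact (relE_map f s y x).1 (e.symm ((relE_map f s x y).2 h))
    · exact (relE_map f s x z).1 (e.trans ((relE_map f s x y).2 h) ((relE_map f s y z).2 h'))
  nested s t hst x y h := (relE_map f t x y).1 (hY.nested s t hst _ _ ((relE_map f s x y).2 h))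
  exists_max hS x y hxy := by
    simpa only [relE_map] using hY.exists_max hS (f x) (f y) (f.injective.ne hxy)

lemma isFraisseLimit (𝔘 : UTuple) : FirstOrder.Language.IsFraisseLimit 𝔘.finiteClass (Pt 𝔘) where
  ultrahomogeneous := by
    classical
    rw [FirstOrder.Language.isUltrahomogeneous_iff_IsExtensionPair FirstOrder.Language.Structure.cg_of_countable,
      FirstOrder.Language.isExtensionPair_iff_exists_embedding_closure_singleton_sup]
    intro D hD φ m
    have hfin : (D : Set (Pt 𝔘)).Finite := by
      have := hD.finite
      exact Set.toFinite _
    let f : Pt 𝔘 → Pt 𝔘 := fun z => if h : z ∈ D then φ ⟨z, h⟩ else z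
    have hfD : ∀ z (h : z ∈ D), f z = φ ⟨z, h⟩ := fun z h => by simp [f, h]
    have hpe : PEmb f (hfin.toFinset : Set (Pt 𝔘)) := by
      rw [Set.Finite.coe_toFinset]
      refine ⟨fun y hy z hz h => ?_, fun s y hy z hz => ?_, fun i v hv => ?_⟩
      · rw [hfD y hy, hfD z hz] at h
        exact congrArg Subtype.val (φ.injective h)
      · rw [hfD y hy, hfD z hz, relE_map φ]
        exact (relE_map D.subtype s ⟨y, hy⟩ ⟨z, hz⟩).symm
      · have : f ∘ v = φ ∘ fun j => (⟨v j, hv j⟩ : D) := funext fun j => hfD _ (hv j)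
        rw [this, relP_map φ]
        exact (relP_map D.subtype i fun j => (⟨v j, hv j⟩ : D)).symm
    obtain ⟨g, hg, hgp⟩ := extend_finset (isUStructure 𝔘) f hfin.toFinset hpe {m}
    rw [Set.Finite.coe_toFinset, Finset.coe_singleton] at hgp
    set D' := FirstOrder.Language.Substructure.closure 𝔘.lang {m} ⊔ D with hD'
    have hsub : ∀ z ∈ D', z ∈ (D : Set (Pt 𝔘)) ∪ {m} := by
      intro z hz
      have h1 : D' ≤ FirstOrder.Language.Substructure.closure 𝔘.lang ((D : Set (Pt 𝔘)) ∪ {m}) := by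
        refine sup_le (FirstOrder.Language.Substructure.closure_mono Set.subset_union_right) ?_
        intro w hw
        exact FirstOrder.Language.Substructure.subset_closure (Or.inl hw)
      have h2 := h1 hz
      rwa [← SetLike.mem_coe, FirstOrder.Language.Substructure.closure_eq_of_isRelational] at h2
    refine ⟨mkEmbedding (fun z : D' => g z) ?_ ?_ ?_, ?_⟩
    · intro y z h
      exact Subtype.ext (hgp.inj (hsub _ y.2) (hsub _ z.2) h)
    · intro s y z
      exact (hgp.relE s y (hsub _ y.2) z (hsub _ z.2)).trans (relE_map D'.subtype s y z)
    · intro i v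
      exact (hgp.relP i (fun j => (v j : Pt 𝔘)) fun j => hsub _ (v j).2).trans
        (relP_map D'.subtype i v)
    · ext z
      exact ((hg z (by simp)).trans (hfD z z.2)).symm
  age := by
    ext X
    constructor
    · rintro ⟨hfg, ⟨φ⟩⟩
      exact ⟨hfg.finite, isUStructure_of_embedding (isUStructure 𝔘) φ⟩
    · rintro ⟨hfin, hX⟩
      have : Fintype X := Fintype.ofFinite X
      refine ⟨FirstOrder.Language.Structure.fg_iff_finite.2 hfin, ?_⟩
      have h0 : PEmb (fun _ : X => ((0 : T 𝔘 →₀ ℕ) : Pt 𝔘)) ((∅ : Finset X) : Set X) := by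
        refine ⟨fun _ h => absurd h (by simp), fun _ _ h => absurd h (by simp), fun i v hv => ?_⟩
        exact absurd (hv ⟨0, 𝔘.arity_pos i⟩) (by simp)
      obtain ⟨g, -, hg⟩ := extend_finset hX _ ∅ h0 Finset.univ
      exact ⟨mkEmbedding g (fun y z h => hg.inj (by simp) (by simp) h)
        (fun s y z => hg.relE s y (by simp) z (by simp))
        (fun i v => hg.relP i v (by simp))⟩

end Model

theorem exists_limit (𝔘 : UTuple) :
    ∃ M : CategoryTheory.Bundled.{0} 𝔘.lang.Structure, ∃ _ : Countable M,
      FirstOrder.Language.IsFraisseLimit 𝔘.finiteClass M :=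
  ⟨⟨Model.Pt 𝔘, inferInstance⟩, inferInstanceAs (Countable (Model.Pt 𝔘)), Model.isFraisseLimit 𝔘⟩

/-- The randomised ultrametric space `𝐔` corresponding to `𝔘`: the Fraïssé limit of the class of
finite `𝔘`-structures. It is unique up to isomorphism, and only the two facts
`countable_space` and `isFraisseLimit_space` determine it. -/
def Space (𝔘 : UTuple) : Type := 𝔘.exists_limit.choose

noncomputable instance (𝔘 : UTuple) : 𝔘.lang.Structure 𝔘.Space := 𝔘.exists_limit.choose.str

instance countable_space (𝔘 : UTuple) : Countable 𝔘.Space := 𝔘.exists_limit.choose_spec.choose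

theorem isFraisseLimit_space (𝔘 : UTuple) : FirstOrder.Language.IsFraisseLimit 𝔘.finiteClass 𝔘.Space :=
  𝔘.exists_limit.choose_spec.choose_spec

/-- The automorphism group of `𝐔`. -/
def Aut (𝔘 : UTuple) : Type := 𝔘.Space ≃[𝔘.lang] 𝔘.Space

noncomputable instance (𝔘 : UTuple) : FunLike 𝔘.Aut 𝔘.Space 𝔘.Space :=
  inferInstanceAs (FunLike (𝔘.Space ≃[𝔘.lang] 𝔘.Space) 𝔘.Space 𝔘.Space)

noncomputable instance (𝔘 : UTuple) : Group 𝔘.Aut where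
  mul g h := FirstOrder.Language.Equiv.comp g h
  one := FirstOrder.Language.Equiv.refl 𝔘.lang 𝔘.Space
  inv g := FirstOrder.Language.Equiv.symm g
  mul_assoc _ _ _ := rfl
  one_mul _ := rfl
  mul_one _ := rfl
  inv_mul_cancel g := FirstOrder.Language.Equiv.ext fun x => FirstOrder.Language.Equiv.symm_apply_apply g x

/-- The topology of pointwise convergence, where `𝐔` is discrete. -/
noncomputable instance (𝔘 : UTuple) : TopologicalSpace 𝔘.Aut :=
  TopologicalSpace.induced (fun (g : 𝔘.Aut) (x : 𝔘.Space) => g x)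
    (@Pi.topologicalSpace 𝔘.Space (fun _ => 𝔘.Space) fun _ => ⊥)

end UTuple

/-- The space of representations of the discrete group `Γ` in the topological group `G`. -/
def GroupRep (Γ G : Type*) [Group Γ] [Group G] : Type _ := Γ →* G

namespace GroupRep

variable {Γ G : Type*} [Group Γ] [Group G]

/-- The value `π γ` of the representation `π` at `γ`. -/
def eval (π : GroupRep Γ G) (γ : Γ) : G := DFunLike.coe (F := Γ →* G) π γ

/-- The topology inherited from the product topology of `G ^ Γ`. -/
instance [TopologicalSpace G] : TopologicalSpace (GroupRep Γ G) :=
  TopologicalSpace.induced eval Pi.topologicalSpace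

/-- The restriction of a representation to a subgroup. -/
def restrict (π : GroupRep Γ G) (Δ : Subgroup Γ) : GroupRep Δ G :=
  MonoidHom.comp (π : Γ →* G) Δ.subtype

/-- The orbit of `π` under conjugation by elements of `G`. -/
def orbit (π : GroupRep Γ G) : Set (GroupRep Γ G) :=
  {θ | ∃ g : G, ∀ γ : Γ, g * π.eval γ * g⁻¹ = θ.eval γ}

/-- `π` is generic if its orbit is comeagre. -/
def IsGeneric [TopologicalSpace G] (π : GroupRep Γ G) : Prop :=
  π.orbit ∈ residual (GroupRep Γ G)

end GroupRep

/-! Call a representation of a finitely generated abelian group rich (`Rich`) if its orbits are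
finite and it has the following extension property: whenever a finite `𝔘`-structure with an action
of the group contains an invariant part lying in `𝐔`, on which the action is that of the
representation, the whole structure embeds equivariantly in `𝐔` over that part. Three facts give the
theorem. Rich representations form a comeagre set (`rich_mem_residual`). Any two of them are
conjugate, by back-and-forth (`Rich.mem_orbit`); hence each of them is generic. The restriction of a
rich representation to a subgroup `Δ` is rich (`Rich.restrict`). As the space of representations is
Polish, a rich `π` exists, and both `π` and `π|Δ` are generic.

The first and the third fact rest on one amalgamation, `exists_amalgam`. Let `Γ` act on `X` and let
`Δ` act on a finite `B`, with a common `Δ`-invariant part `A`. The induced structure `Γ ×_Δ B` is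
glued to `X` along the translates of `A`, with distances measured through `X` where necessary and
with no further relations `P i`. The result need not be finite, but a prescribed finite part of it
survives in a finite quotient (`exists_finite_quotient`), obtained by dividing by the `n`-th powers
for a sufficiently divisible `n`. Such an `n` exists because subgroups of finitely generated abelian
groups, here of powers of `Γ`, are closed in the profinite topology (`exists_separating_power`).

The amalgamation is used with three kinds of subgroup. With the trivial subgroup it adds a point to
a finite action, so that finite actions on substructures of `𝐔` extend to representations
(`Stage.exists_rep`). With `Δ = Γ` it yields the density of the extension property
(`exists_rep_approx`). With a general `Δ` it lifts an extension problem for `Δ` to one for `Γ`,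
which gives `Rich.restrict`. -/

namespace UTuple

/-! ### Relations, actions and partial embeddings -/

section Basic

variable {𝔘 : UTuple}

/-- The structure with prescribed interpretations of the symbols. -/
abbrev mkStructure {X : Type*} (e : 𝔘.S → X → X → Prop)
    (p : ∀ i : Fin 𝔘.r, (Fin (𝔘.arity i) → X) → Prop) : 𝔘.lang.Structure X where
  funMap f := Empty.elim f
  RelMap := fun {_} R => match (R : 𝔘.Rel _) with
    | .E s => fun v => e s (v 0) (v 1)
    | .P i => fun v => p i v

/-- Subsets carry the induced structure. -/
instance subtypeStructure {X : Type*} [𝔘.lang.Structure X] (p : X → Prop) :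
    𝔘.lang.Structure (Subtype p) :=
  mkStructure (fun s x y => 𝔘.relE s x.1 y.1) (fun i v => 𝔘.relP i (Subtype.val ∘ v))

variable {Z X Y W : Type*} [𝔘.lang.Structure X] [𝔘.lang.Structure Y] [𝔘.lang.Structure W]

variable (𝔘) in
/-- The maps `f` and `g` induce the same relations on `A`. -/
structure Same (f : Z → X) (g : Z → Y) (A : Set Z) : Prop where
  eq : ∀ x ∈ A, ∀ y ∈ A, f x = f y ↔ g x = g y
  relE : ∀ s, ∀ x ∈ A, ∀ y ∈ A, 𝔘.relE s (f x) (f y) ↔ 𝔘.relE s (g x) (g y)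
  relP : ∀ i, ∀ v : Fin (𝔘.arity i) → Z, (∀ j, v j ∈ A) → (𝔘.relP i (f ∘ v) ↔ 𝔘.relP i (g ∘ v))

namespace Same

lemma symm {f : Z → X} {g : Z → Y} {A : Set Z} (h : Same 𝔘 f g A) : Same 𝔘 g f A :=
  ⟨fun x hx y hy => (h.eq x hx y hy).symm, fun s x hx y hy => (h.relE s x hx y hy).symm,
    fun i v hv => (h.relP i v hv).symm⟩

lemma trans {f : Z → X} {g : Z → Y} {k : Z → W} {A : Set Z} (h : Same 𝔘 f g A)
    (h' : Same 𝔘 g k A) : Same 𝔘 f k A :=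
  ⟨fun x hx y hy => (h.eq x hx y hy).trans (h'.eq x hx y hy),
    fun s x hx y hy => (h.relE s x hx y hy).trans (h'.relE s x hx y hy),
    fun i v hv => (h.relP i v hv).trans (h'.relP i v hv)⟩

lemma comp {T : Type*} {f : Z → X} {g : Z → Y} {A : Set Z} (h : Same 𝔘 f g A) (k : T → Z)
    {B : Set T} (hk : ∀ x ∈ B, k x ∈ A) : Same 𝔘 (f ∘ k) (g ∘ k) B :=
  ⟨fun x hx y hy => h.eq _ (hk x hx) _ (hk y hy),
    fun s x hx y hy => h.relE s _ (hk x hx) _ (hk y hy),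
    fun i v hv => h.relP i (k ∘ v) fun j => hk _ (hv j)⟩

lemma mono {f : Z → X} {g : Z → Y} {A B : Set Z} (h : Same 𝔘 f g A) (hB : B ⊆ A) :
    Same 𝔘 f g B :=
  h.comp id hB

lemma congr {f f' : Z → X} {g g' : Z → Y} {A : Set Z} (h : Same 𝔘 f g A)
    (hf : ∀ x ∈ A, f' x = f x) (hg : ∀ x ∈ A, g' x = g x) : Same 𝔘 f' g' A where
  eq x hx y hy := by rw [hf x hx, hf y hy, hg x hx, hg y hy]; exact h.eq x hx y hy
  relE s x hx y hy := by rw [hf x hx, hf y hy, hg x hx, hg y hy]; exact h.relE s x hx y hy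
  relP i v hv := by
    have h1 : f' ∘ v = f ∘ v := funext fun j => hf _ (hv j)
    have h2 : g' ∘ v = g ∘ v := funext fun j => hg _ (hv j)
    rw [h1, h2]; exact h.relP i v hv

lemma rfl' {f : Z → X} {A : Set Z} : Same 𝔘 f f A :=
  ⟨fun _ _ _ _ => Iff.rfl, fun _ _ _ _ _ => Iff.rfl, fun _ _ _ => Iff.rfl⟩

end Same

variable (𝔘) in
/-- `f` is an embedding of the substructure of `X` with universe `A`. -/
abbrev EmbOn (f : X → Y) (A : Set X) : Prop := Same 𝔘 f id A

lemma embOn_subtype_val (p : X → Prop) : EmbOn 𝔘 (Subtype.val : Subtype p → X) Set.univ :=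
  ⟨fun _ _ _ _ => Subtype.ext_iff.symm, fun _ _ _ _ _ => Iff.rfl, fun _ _ _ => Iff.rfl⟩

/-- An injective map that respects the relations is an embedding. -/
def EmbOn.toEmbedding {f : X → Y} (h : EmbOn 𝔘 f Set.univ) : X ↪[𝔘.lang] Y :=
  Model.mkEmbedding f (fun x y hxy => (h.eq x trivial y trivial).1 hxy)
    (fun s x y => h.relE s x trivial y trivial) (fun i v => h.relP i v fun _ => trivial)

lemma embOn_of_embedding (f : X ↪[𝔘.lang] Y) : EmbOn 𝔘 f Set.univ :=
  ⟨fun _ _ _ _ => f.injective.eq_iff, fun s x _ y _ => Model.relE_map f s x y,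
    fun i v _ => Model.relP_map f i v⟩

lemma isUStructure_of_embOn (hY : 𝔘.IsUStructure Y) {f : X → Y} (h : EmbOn 𝔘 f Set.univ) :
    𝔘.IsUStructure X :=
  Model.isUStructure_of_embedding hY h.toEmbedding

variable (𝔘) in
/-- An action of the group `Γ` on `X` by automorphisms. -/
structure UAct (Γ : Type*) [Group Γ] (X : Type*) [𝔘.lang.Structure X] where
  act : Γ → X → X
  one : ∀ x, act 1 x = x
  mul : ∀ γ δ x, act (γ * δ) x = act γ (act δ x)
  same : ∀ γ, EmbOn 𝔘 (act γ) Set.univ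

namespace UAct

variable {Γ : Type*} [Group Γ] (a : UAct 𝔘 Γ X)

lemma inv_act (γ : Γ) (x : X) : a.act γ⁻¹ (a.act γ x) = x := by
  rw [← a.mul, inv_mul_cancel, a.one]

lemma act_inv (γ : Γ) (x : X) : a.act γ (a.act γ⁻¹ x) = x := by
  rw [← a.mul, mul_inv_cancel, a.one]

lemma inj (γ : Γ) {x y : X} : a.act γ x = a.act γ y ↔ x = y :=
  (a.same γ).eq x trivial y trivial

lemma relE_act (γ : Γ) (s : 𝔘.S) (x y : X) :
    𝔘.relE s (a.act γ x) (a.act γ y) ↔ 𝔘.relE s x y :=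
  (a.same γ).relE s x trivial y trivial

lemma relP_act (γ : Γ) (i : Fin 𝔘.r) (v : Fin (𝔘.arity i) → X) :
    𝔘.relP i (fun j => a.act γ (v j)) ↔ 𝔘.relP i v :=
  (a.same γ).relP i v fun _ => trivial

/-- The restriction of an action to a subgroup. -/
def restrict (Δ : Subgroup Γ) : UAct 𝔘 Δ X :=
  ⟨fun δ => a.act δ, a.one, fun γ δ => a.mul γ δ, fun γ => a.same γ⟩

/-- The restriction of an action to an invariant subset. -/
def onSubtype (p : X → Prop) (hp : ∀ γ x, p x → p (a.act γ x)) : UAct 𝔘 Γ (Subtype p) where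
  act γ x := ⟨a.act γ x.1, hp γ _ x.2⟩
  one _ := Subtype.ext (a.one _)
  mul _ _ _ := Subtype.ext (a.mul _ _ _)
  same γ := ⟨fun _ _ _ _ => Subtype.ext_iff.trans ((a.inj γ).trans Subtype.ext_iff.symm),
    fun s x _ y _ => a.relE_act γ s x.1 y.1, fun i v _ => a.relP_act γ i (Subtype.val ∘ v)⟩

variable (𝔘 Γ X) in
/-- The trivial action. -/
def trivialAct : UAct 𝔘 Γ X := ⟨fun _ x => x, fun _ => rfl, fun _ _ _ => rfl, fun _ => Same.rfl'⟩

/-- Transport of an action along a bijection that respects the relations. -/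
def transport (e : X ≃ Y) (he : EmbOn 𝔘 e Set.univ) : UAct 𝔘 Γ Y where
  act γ y := e (a.act γ (e.symm y))
  one y := by simp [a.one]
  mul γ δ y := by simp [a.mul]
  same γ := by
    have h1 : EmbOn 𝔘 (e ∘ a.act γ) Set.univ :=
      (he.comp (a.act γ) fun _ _ => trivial).trans (a.same γ)
    refine ((h1.trans he.symm).comp e.symm (B := Set.univ) fun _ _ => trivial).congr
      (fun _ _ => rfl) fun y _ => by simp

end UAct

/-! ### Distances -/

/-- The relation `d x y ≤ t`, where `d x y < s` if and only if `x E_s y`. -/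
def lev (t : WithBot 𝔘.S) (x y : X) : Prop :=
  (t = ⊥ → x = y) ∧ ∀ s : 𝔘.S, t < s → 𝔘.relE s x y

lemma lev_bot (hX : 𝔘.IsUStructure X) (x y : X) : lev (𝔘 := 𝔘) ⊥ x y ↔ x = y :=
  ⟨fun h => h.1 rfl, by rintro rfl; exact ⟨fun _ => rfl, fun s _ => (hX.equivalence s).refl _⟩⟩

lemma lev_mono {t u : WithBot 𝔘.S} (h : t ≤ u) {x y : X} (hxy : lev t x y) : lev u x y :=
  ⟨fun hu => hxy.1 (le_bot_iff.1 (hu ▸ h)), fun s hs => hxy.2 s (h.trans_lt hs)⟩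

lemma lev_equivalence (hX : 𝔘.IsUStructure X) (t : WithBot 𝔘.S) :
    Equivalence (lev t : X → X → Prop) :=
  ⟨fun _ => ⟨fun _ => rfl, fun s _ => (hX.equivalence s).refl _⟩,
    fun h => ⟨fun ht => (h.1 ht).symm, fun s hs => (hX.equivalence s).symm (h.2 s hs)⟩,
    fun h h' => ⟨fun ht => (h.1 ht).trans (h'.1 ht),
      fun s hs => (hX.equivalence s).trans (h.2 s hs) (h'.2 s hs)⟩⟩

lemma Same.lev_iff {f : Z → X} {g : Z → Y} {A : Set Z} (h : Same 𝔘 f g A) (t : WithBot 𝔘.S)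
    {x y : Z} (hx : x ∈ A) (hy : y ∈ A) : lev t (f x) (f y) ↔ lev t (g x) (g y) := by
  simp only [lev, h.eq x hx y hy, h.relE _ x hx y hy]

lemma UAct.lev_act {Γ : Type*} [Group Γ] (a : UAct 𝔘 Γ X) (γ : Γ) (t : WithBot 𝔘.S) (x y : X) :
    lev t (a.act γ x) (a.act γ y) ↔ lev t x y :=
  (a.same γ).lev_iff t trivial trivial

/-- The distance is the maximal `s` for which `E s` fails, and `⊥` for equal points. If `S` is
empty, distinct points have no distance at all, so this case is excluded here. -/
lemma exists_dist (hX : 𝔘.IsUStructure X) (hS : 𝔘.S.Nonempty) (x y : X) :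
    ∃ d : WithBot 𝔘.S, (∀ t, lev t x y ↔ d ≤ t) ∧ ∀ s : 𝔘.S, 𝔘.relE s x y ↔ d < s := by
  suffices h : ∃ d : WithBot 𝔘.S, (d = ⊥ ↔ x = y) ∧ ∀ s : 𝔘.S, 𝔘.relE s x y ↔ d < s by
    obtain ⟨d, hd, h⟩ := h
    refine ⟨d, fun t => ?_, h⟩
    simp only [lev, h, ← hd]
    constructor
    · rintro ⟨h1, h2⟩
      induction d with
      | bot => exact bot_le
      | coe d => exact not_lt.1 fun hc => lt_irrefl _ (h2 d hc)
    · exact fun hdt => ⟨fun ht => le_bot_iff.1 (ht ▸ hdt), fun s hs => hdt.trans_lt hs⟩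
  by_cases hxy : x = y
  · subst hxy
    exact ⟨⊥, by simp, fun s => iff_of_true ((hX.equivalence s).refl _) (WithBot.bot_lt_coe s)⟩
  · obtain ⟨m, hm, hmax⟩ := hX.exists_max hS x y hxy
    refine ⟨m, by simp [hxy], fun s => ⟨fun hs => ?_, fun hs => ?_⟩⟩
    · rw [WithBot.coe_lt_coe]
      by_contra hc
      rcases (not_lt.1 hc).lt_or_eq with h1 | h1
      · exact hm (hX.nested s m h1 _ _ hs)
      · exact hm (h1 ▸ hs)
    · rw [WithBot.coe_lt_coe] at hs
      by_contra hc
      exact absurd (hmax hc) (not_le.2 hs)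

/-- Quantifying over `s` before `d` makes the statement vacuous when `S` is empty and distances need
not exist. -/
lemma exists_finset_dist (hX : 𝔘.IsUStructure X) (ι : Z → X) [Finite Z] :
    ∃ T : Finset (WithBot 𝔘.S), ∀ s : 𝔘.S, ∀ x y : Z, ∃ d ∈ T,
      (∀ t, lev t (ι x) (ι y) ↔ d ≤ t) ∧ (𝔘.relE s (ι x) (ι y) ↔ d < s) := by
  classical
  by_cases hS : 𝔘.S.Nonempty
  · have := Fintype.ofFinite Z
    choose d hd using fun x y : Z => exists_dist hX hS (ι x) (ι y)
    exact ⟨Finset.univ.image fun p : Z × Z => d p.1 p.2, fun s x y =>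
      ⟨d x y, Finset.mem_image_of_mem (fun p : Z × Z => d p.1 p.2) (Finset.mem_univ (x, y)),
        (hd x y).1, (hd x y).2 s⟩⟩
  · exact ⟨∅, fun s => absurd ⟨s.1, s.2⟩ hS⟩

/-- A finite increasing chain of equivalence relations, starting with equality and ending with the
total relation, and compatible relations `p i` define a `𝔘`-structure. -/
lemma isUStructure_of_chain {D : Type*} (T : Finset (WithBot 𝔘.S)) (hT : ⊥ ∈ T)
    (G : WithBot 𝔘.S → D → D → Prop) (hG : ∀ t, Equivalence (G t))
    (hmono : ∀ t u, t ≤ u → ∀ x y, G t x y → G u x y) (hbot : ∀ x y, G ⊥ x y → x = y)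
    (htop : 𝔘.S.Nonempty → ∃ t ∈ T, ∀ x y, G t x y)
    (p : ∀ i : Fin 𝔘.r, (Fin (𝔘.arity i) → D) → Prop)
    (hsymm : ∀ i, ∀ ϑ ∈ 𝔘.L i, ∀ v, p i v → p i (v ∘ ϑ))
    (hinj : ∀ i v, p i v → Function.Injective v) :
    @IsUStructure 𝔘 D (mkStructure (fun s x y => ∃ t ∈ T, t < s ∧ G t x y) p) := by
  classical
  let := mkStructure (𝔘 := 𝔘) (fun s x y => ∃ t ∈ T, t < s ∧ G t x y) p
  have hE : ∀ (s : 𝔘.S) (x y : D), 𝔘.relE s x y ↔ ∃ t ∈ T, t < s ∧ G t x y :=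
    fun _ _ _ => Iff.rfl
  refine ⟨fun i ϑ hϑ v => ⟨fun h => ?_, hsymm i ϑ hϑ v⟩, hinj, fun s => ⟨fun x => ?_, ?_, ?_⟩,
    ?_, ?_⟩
  · have := hsymm i ϑ⁻¹ (inv_mem hϑ) _ h
    have e : (v ∘ ϑ) ∘ ⇑ϑ⁻¹ = v := by funext j; simp
    rwa [e] at this
  · exact ⟨⊥, hT, WithBot.bot_lt_coe s, (hG ⊥).refl x⟩
  · rintro x y ⟨t, ht, hts, h⟩
    exact ⟨t, ht, hts, (hG t).symm h⟩
  · rintro x y z ⟨t, ht, hts, h⟩ ⟨u, hu, hus, h'⟩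
    rcases le_total t u with htu | htu
    · exact ⟨u, hu, hus, (hG u).trans (hmono t u htu _ _ h) h'⟩
    · exact ⟨t, ht, hts, (hG t).trans h (hmono u t htu _ _ h')⟩
  · rintro s s' hs x y ⟨t, ht, hts, h⟩
    exact ⟨t, ht, hts.trans (WithBot.coe_lt_coe.2 hs), h⟩
  · intro hS x y hxy
    obtain ⟨m, hm, hmt⟩ := htop hS
    -- The least level in `T` that relates `x` and `y` is their distance. The finiteness of `T`
    -- guarantees that it exists even if `S` is not well-ordered.
    obtain ⟨t, ht, hmin⟩ := Finset.exists_min_image (T.filter fun t => G t x y) id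
      ⟨m, Finset.mem_filter.2 ⟨hm, hmt x y⟩⟩
    rw [Finset.mem_filter] at ht
    induction t with
    | bot => exact absurd (hbot x y ht.2) hxy
    | coe t =>
      refine ⟨t, ?_, fun s hs => ?_⟩
      · rintro ⟨u, hu, hut, h⟩
        exact absurd (hmin u (Finset.mem_filter.2 ⟨hu, h⟩)) (not_le.2 hut)
      · by_contra hc
        exact hs ⟨t, ht.1, WithBot.coe_lt_coe.2 (not_le.1 hc), ht.2⟩

end Basic

end UTuple

/-! ### Separation in finitely generated abelian groups -/

/-- A nontrivial element of a finitely generated abelian group is not an `m`-th power for some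
`m`. -/
lemma exists_forall_pow_ne {G : Type*} [CommGroup G] [Group.FG G] {x : G} (hx : x ≠ 1) :
    ∃ m : ℕ, 0 < m ∧ ∀ g : G, g ^ m ≠ x := by
  obtain ⟨ι, κ, _, _, p, hp, e, ⟨f⟩⟩ := CommGroup.equiv_free_prod_prod_multiplicative_zmod G
  have hfx : f x ≠ 1 := by simpa using hx
  by_cases h1 : (f x).1 = 1
  -- Here `x` is a torsion element. This exponent kills the torsion part of every `g`, hence would
  -- kill `x`.
  · refine ⟨∏ i, p i ^ e i, Finset.prod_pos fun i _ => pow_pos (hp i).pos _, fun g hg => hfx ?_⟩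
    refine Prod.ext h1 ?_
    funext i
    rw [← hg, map_pow]
    obtain ⟨c, hc⟩ := Finset.dvd_prod_of_mem (fun i => p i ^ e i) (Finset.mem_univ i)
    rw [hc]
    apply Multiplicative.toAdd.injective
    change (p i ^ e i * c) • Multiplicative.toAdd ((f g).2 i) = 0
    rw [mul_comm, mul_smul]
    simp
  · obtain ⟨i, hi⟩ := Function.ne_iff.1 h1
    have hz : Multiplicative.toAdd ((f x).1 i) ≠ 0 := hi
    -- A nonzero integer is not divisible by anything larger than its absolute value.
    refine ⟨(Multiplicative.toAdd ((f x).1 i)).natAbs + 1, Nat.succ_pos _, fun g hg => ?_⟩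
    have h2 : ((Multiplicative.toAdd ((f x).1 i)).natAbs + 1) • Multiplicative.toAdd ((f g).1 i)
        = Multiplicative.toAdd ((f x).1 i) := by
      conv_rhs => rw [← hg, map_pow]
      rfl
    rw [nsmul_eq_mul] at h2
    have h3 := Int.natAbs_dvd_natAbs.2 (Dvd.intro _ h2)
    have h4 := Nat.le_of_dvd (Int.natAbs_pos.2 hz) h3
    simp only [Int.natAbs_natCast] at h4
    omega

/-- Subgroups of finitely generated abelian groups are closed in the profinite topology. -/
lemma exists_forall_mul_pow_notMem {G : Type*} [CommGroup G] [Group.FG G] (K : Subgroup G)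
    {h : G} (hh : h ∉ K) : ∃ m : ℕ, 0 < m ∧ ∀ n, m ∣ n → ∀ g : G, h * g ^ n ∉ K := by
  have hne : (QuotientGroup.mk' K h) ≠ 1 := fun hc => hh ((QuotientGroup.eq_one_iff h).1 hc)
  have : Group.FG (G ⧸ K) := inferInstance
  obtain ⟨m, hm, H⟩ := exists_forall_pow_ne hne
  refine ⟨m, hm, ?_⟩
  rintro _ ⟨c, rfl⟩ g hg
  refine H (QuotientGroup.mk' K (g ^ c)⁻¹) ?_
  have h1 : QuotientGroup.mk' K (h * g ^ (m * c)) = 1 := (QuotientGroup.eq_one_iff _).2 hg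
  rw [map_mul, mul_comm m c, pow_mul, map_pow] at h1
  rw [map_inv, inv_pow]
  exact (eq_inv_of_mul_eq_one_left h1).symm

/-- Tuples in different orbits remain in different orbits modulo the subgroup of `n`-th powers, if
`n` is sufficiently divisible. -/
lemma exists_separating_power {Γ Y κ : Type*} [CommGroup Γ] [Group.FG Γ] [Finite κ]
    (a : Γ → Y → Y) (ha1 : ∀ y, a 1 y = y) (hamul : ∀ γ δ y, a (γ * δ) y = a γ (a δ y))
    (R : Y → Y → Prop) (hR : Equivalence R) (hRa : ∀ γ x y, R x y → R (a γ x) (a γ y))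
    (z w : κ → Y) :
    ∃ m : ℕ, 0 < m ∧ ∀ n, m ∣ n →
      (∃ γ, ∀ j, ∃ g : Γ, R (z j) (a (g ^ n * γ) (w j))) → ∃ γ, ∀ j, R (z j) (a γ (w j)) := by
  by_cases horb : ∀ j, ∃ h, R (z j) (a h (w j))
  swap
  -- If some `z j` is not in the orbit of `w j` up to `R`, the premise fails for every `n`, since `g
  -- ^ n * γ` is itself an element of `Γ`.
  · refine ⟨1, one_pos, fun n _ ⟨γ, h⟩ => absurd (fun j => ?_) horb⟩
    obtain ⟨g, hg⟩ := h j
    exact ⟨_, hg⟩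
  choose h hh using horb
  have hcancel : ∀ γ δ x y, R (a γ x) (a δ y) → R x (a (γ⁻¹ * δ) y) := fun γ δ x y hxy => by
    have := hRa γ⁻¹ _ _ hxy
    rwa [← hamul, ← hamul, inv_mul_cancel, ha1] at this
  -- `K` is the product of the diagonal and of the stabilisers of the `R`-classes of the `w j`;
  -- commutativity makes it a subgroup. Since `z j` is `h j` applied to `w j` up to `R`, one element
  -- of `Γ` moves the whole tuple `w` to `z` if and only if `h ∈ K`. If it holds only up to `n`-th
  -- powers, then `h` lies in `K` up to an `n`-th power in `κ → Γ`.
  let K : Subgroup (κ → Γ) :=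
    { carrier := {c | ∃ γ, ∀ j, R (w j) (a (γ * c j) (w j))}
      one_mem' := ⟨1, fun j => by simpa [ha1] using hR.refl _⟩
      mul_mem' := by
        rintro c d ⟨γ, hγ⟩ ⟨δ, hδ⟩
        refine ⟨γ * δ, fun j => hR.trans (hγ j) ?_⟩
        have := hRa (γ * c j) _ _ (hδ j)
        rwa [← hamul, mul_mul_mul_comm] at this
      inv_mem' := by
        rintro c ⟨γ, hγ⟩
        refine ⟨γ⁻¹, fun j => ?_⟩
        have h1 := hcancel (γ * c j) 1 (w j) (w j) (by simpa [ha1] using hR.symm (hγ j))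
        simpa [mul_comm] using h1 }
  by_cases hK : h ∈ K
  · obtain ⟨γ, hγ⟩ := hK
    refine ⟨1, one_pos, fun n _ _ => ⟨γ⁻¹, fun j => hR.trans (hh j) ?_⟩⟩
    have := hRa γ⁻¹ _ _ (hγ j)
    rw [← hamul, inv_mul_cancel_left] at this
    exact hR.symm this
  · obtain ⟨m, hm, H⟩ := exists_forall_mul_pow_notMem K hK
    refine ⟨m, hm, fun n hn ⟨γ, hγ⟩ => ?_⟩
    choose g hg using hγ
    refine absurd ?_ (H n hn g⁻¹)
    refine ⟨γ⁻¹, fun j => ?_⟩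
    have h1 := hcancel _ _ _ _ (hR.symm ((hR.trans (hR.symm (hh j)) (hg j))))
    have h2 : γ⁻¹ * (h * g⁻¹ ^ n) j = (g j ^ n * γ)⁻¹ * h j := by
      simp only [Pi.mul_apply, Pi.pow_apply, Pi.inv_apply, mul_inv, inv_pow]
      rw [mul_comm (h j), ← mul_assoc, mul_comm γ⁻¹]
    rwa [h2]

namespace UTuple

lemma exists_pos_forall_dvd {ι : Type*} [Finite ι] (m : ι → ℕ) (hm : ∀ i, 0 < m i) :
    ∃ n, 0 < n ∧ ∀ i, m i ∣ n := by
  have := Fintype.ofFinite ι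
  exact ⟨∏ i, m i, Finset.prod_pos fun i _ => hm i,
    fun i => Finset.dvd_prod_of_mem m (Finset.mem_univ i)⟩

universe u v w

/-! ### Finite quotients of actions of finitely generated abelian groups. -/

section Quotient

variable {𝔘 : UTuple} {Γ : Type u} {Y : Type*} {Z : Type v} [CommGroup Γ]

/-- Let `a` be an action of `Γ` on `Y`, let `F t` be invariant equivalence relations, increasing
with `t`, and let `h : Z → Y` be a map from a finite set. Then there are a finite `𝔘`-structure `D`
with an action of `Γ` and a map `q : Z → D` such that the relations among the points `q z` are those
described by `F` and by the translates of the tuples in `T`. -/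
lemma exists_finite_quotient [Group.FG Γ] [Finite Z]
    (a : Γ → Y → Y) (ha1 : ∀ y, a 1 y = y) (hamul : ∀ γ δ y, a (γ * δ) y = a γ (a δ y))
    (F : WithBot 𝔘.S → Y → Y → Prop) (hF : ∀ t, Equivalence (F t))
    (hmono : ∀ t u, t ≤ u → ∀ x y, F t x y → F u x y)
    (hFa : ∀ t γ x y, F t x y → F t (a γ x) (a γ y)) (h : Z → Y)
    (T : ∀ i, Set (Fin (𝔘.arity i) → Z)) (hT : ∀ i, ∀ ϑ ∈ 𝔘.L i, ∀ v ∈ T i, v ∘ ϑ ∈ T i)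
    (hTinj : ∀ i, ∀ v ∈ T i, ∀ j j', F ⊥ (h (v j)) (h (v j')) → j = j')
    (T₀ : Finset (WithBot 𝔘.S)) :
    ∃ (D : Type (max u v)) (_ : 𝔘.lang.Structure D) (_ : Finite D) (_ : 𝔘.IsUStructure D)
      (c : UAct 𝔘 Γ D) (q : Z → D),
      (∀ γ z z', F ⊥ (h z) (a γ (h z')) → q z = c.act γ (q z')) ∧
      (∀ z z', q z = q z' → F ⊥ (h z) (h z')) ∧
      (∀ s z z', ∀ d ∈ T₀, (∀ t, F t (h z) (h z') ↔ d ≤ t) → (𝔘.relE s (q z) (q z') ↔ d < s)) ∧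
      ∀ i v, 𝔘.relP i (q ∘ v) ↔ ∃ w ∈ T i, ∃ γ, ∀ j, F ⊥ (h (v j)) (a γ (h (w j))) := by
  classical
  -- `T₁` is the finite set of distances allowed in `D`. It has a level above `⊥` if possible, so
  -- that its largest level can be made the total relation.
  obtain ⟨T₁, hT₀, hbot, htop⟩ : ∃ T₁ : Finset (WithBot 𝔘.S), T₀ ⊆ T₁ ∧ ⊥ ∈ T₁ ∧
      (𝔘.S.Nonempty → ∃ t ∈ T₁, t ≠ ⊥) := by
    by_cases hS : 𝔘.S.Nonempty
    · obtain ⟨s, hs⟩ := hS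
      refine ⟨insert ⊥ (insert ((⟨s, hs⟩ : 𝔘.S) : WithBot 𝔘.S) T₀), fun t ht => by simp [ht],
        by simp, fun _ => ⟨((⟨s, hs⟩ : 𝔘.S) : WithBot 𝔘.S), by simp, WithBot.coe_ne_bot⟩⟩
    · exact ⟨insert ⊥ T₀, fun t ht => by simp [ht], by simp, fun h => absurd h hS⟩
  obtain ⟨n, hn, sep₂, sepP⟩ : ∃ n : ℕ, 0 < n ∧
      (∀ t ∈ T₁, ∀ z z' : Z, ∀ g : Γ, F t (h z) (a (g ^ n) (h z')) → F t (h z) (h z')) ∧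
      ∀ i, ∀ v w : Fin (𝔘.arity i) → Z,
        (∃ γ, ∀ j, ∃ g : Γ, F ⊥ (h (v j)) (a (g ^ n * γ) (h (w j)))) →
          ∃ γ, ∀ j, F ⊥ (h (v j)) (a γ (h (w j))) := by
    -- For a single point, separation would only put `h z` and `h z'` in one orbit. Comparing the
    -- pair `(h z, h z)` with `(h z, h z')` forces the two points themselves to be `F t`-related.
    choose m hm Hm using fun x : T₁ × Z × Z => exists_separating_power a ha1 hamul (F x.1)
      (hF _) (hFa _) ![h x.2.1, h x.2.1] ![h x.2.1, h x.2.2]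
    choose m' hm' Hm' using fun x : Σ i, (Fin (𝔘.arity i) → Z) × (Fin (𝔘.arity i) → Z) =>
      exists_separating_power a ha1 hamul (F ⊥) (hF _) (hFa _) (h ∘ x.2.1) (h ∘ x.2.2)
    obtain ⟨n, hn, hdvd⟩ := exists_pos_forall_dvd (Sum.elim m m') (by
      rintro (x | x)
      exacts [hm x, hm' x])
    refine ⟨n, hn, fun t ht z z' g hg => ?_, fun i v w => ?_⟩
    · obtain ⟨γ, hγ⟩ := Hm ⟨⟨t, ht⟩, z, z'⟩ n (hdvd (Sum.inl _)) ⟨1, fun j => by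
        fin_cases j
        · exact ⟨1, by simpa [ha1] using (hF t).refl _⟩
        · exact ⟨g, by simpa using hg⟩⟩
      have h0 : F t (h z) (a γ (h z)) := hγ 0
      have h1 : F t (h z) (a γ (h z')) := hγ 1
      have := hFa t γ⁻¹ _ _ ((hF t).trans ((hF t).symm h0) h1)
      simpa only [← hamul, inv_mul_cancel, ha1] using this
    · exact Hm' ⟨i, v, w⟩ n (hdvd (Sum.inr _))
  -- The pairs in `Γ × Z` name the points of the orbits of `h z`, and `L t` is `F t` up to `n`-th
  -- powers.
  let pt : Γ × Z → Y := fun y => a y.1 (h y.2)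
  let L : WithBot 𝔘.S → Γ × Z → Γ × Z → Prop := fun t y y' =>
    ∃ g : Γ, F t (pt y) (a (g ^ n) (pt y'))
  have hL : ∀ t, Equivalence (L t) := fun t => by
    refine ⟨fun y => ⟨1, by simpa [ha1] using (hF t).refl _⟩, ?_, ?_⟩
    · rintro y y' ⟨g, hg⟩
      refine ⟨g⁻¹, (hF t).symm ?_⟩
      have := hFa t (g⁻¹ ^ n) _ _ hg
      rwa [inv_pow, ← hamul _ (g ^ n), inv_mul_cancel, ha1, ← inv_pow] at this
    · rintro y y' y'' ⟨g, hg⟩ ⟨g', hg'⟩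
      refine ⟨g * g', (hF t).trans hg ?_⟩
      have := hFa t (g ^ n) _ _ hg'
      rwa [← hamul _ (g' ^ n), ← mul_pow] at this
  have hLmono : ∀ t u, t ≤ u → ∀ y y', L t y y' → L u y y' :=
    fun t u htu y y' ⟨g, hg⟩ => ⟨g, hmono t u htu _ _ hg⟩
  have hLact : ∀ t γ y y', L t y y' → L t (γ * y.1, y.2) (γ * y'.1, y'.2) := by
    rintro t γ y y' ⟨g, hg⟩
    refine ⟨g, ?_⟩
    have := hFa t γ _ _ hg
    simp only [pt, ← hamul] at this ⊢
    rwa [mul_left_comm] at this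
  let st : Setoid (Γ × Z) := ⟨L ⊥, hL ⊥⟩
  let D := Quotient st
  have hmk : ∀ y y', (Quotient.mk st y : D) = Quotient.mk st y' ↔ L ⊥ y y' :=
    fun y y' => Quotient.eq (r := st)
  have hout : ∀ t y, L t (Quotient.mk st y).out y := fun t y =>
    hLmono ⊥ t bot_le _ _ ((hmk _ _).1 (Quotient.out_eq _))
  -- Points unrelated by every `F t` get the largest distance in `T₁`. This leaves alone the
  -- distances in `T₀`, none of which is larger.
  let G : WithBot 𝔘.S → D → D → Prop := fun t p q =>
    L t p.out q.out ∨ (t ≠ ⊥ ∧ ∀ u ∈ T₁, u ≤ t)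
  have hGmk : ∀ t y y', G t (Quotient.mk st y) (Quotient.mk st y') ↔
      L t y y' ∨ (t ≠ ⊥ ∧ ∀ u ∈ T₁, u ≤ t) := fun t y y' => by
    refine or_congr_left ⟨fun H => ?_, fun H => ?_⟩
    · exact (hL t).trans ((hL t).symm (hout t y)) ((hL t).trans H (hout t y'))
    · exact (hL t).trans (hout t y) ((hL t).trans H ((hL t).symm (hout t y')))
  let P : ∀ i : Fin 𝔘.r, (Fin (𝔘.arity i) → D) → Prop := fun i p =>
    ∃ w ∈ T i, ∃ γ : Γ, ∀ j, p j = Quotient.mk st (γ, w j)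
  let strD : 𝔘.lang.Structure D := mkStructure (fun s x y => ∃ t ∈ T₁, t < s ∧ G t x y) P
  have hE : ∀ (s : 𝔘.S) (x y : D), 𝔘.relE s x y ↔ ∃ t ∈ T₁, t < s ∧ G t x y :=
    fun _ _ _ => Iff.rfl
  have hP : ∀ i (p : Fin (𝔘.arity i) → D), 𝔘.relP i p ↔
      ∃ w ∈ T i, ∃ γ : Γ, ∀ j, p j = Quotient.mk st (γ, w j) := fun _ _ => Iff.rfl
  have hD : 𝔘.IsUStructure D := by
    refine isUStructure_of_chain T₁ hbot G (fun t => ?_) (fun t u htu x y => ?_) ?_ ?_ P ?_ ?_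
    · refine ⟨fun p => Or.inl ((hL t).refl _), ?_, ?_⟩
      · rintro p q (H | H)
        exacts [Or.inl ((hL t).symm H), Or.inr H]
      · rintro p q r (H | H) (H' | H')
        exacts [Or.inl ((hL t).trans H H'), Or.inr H', Or.inr H, Or.inr H]
    · rintro (H | H)
      · exact Or.inl (hLmono t u htu _ _ H)
      · exact Or.inr ⟨fun hu => H.1 (le_bot_iff.1 (hu ▸ htu)), fun v hv => (H.2 v hv).trans htu⟩
    · rintro x y (H | H)
      · rw [← Quotient.out_eq x, ← Quotient.out_eq y]
        exact Quotient.sound H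
      · exact absurd rfl H.1
    · intro hS
      obtain ⟨t, ht, hne⟩ := htop hS
      obtain ⟨m, hm, hmax⟩ := Finset.exists_max_image T₁ id ⟨t, ht⟩
      exact ⟨m, hm, fun _ _ => Or.inr ⟨fun hb => hne (le_bot_iff.1 (hb ▸ hmax t ht)), hmax⟩⟩
    · rintro i ϑ hϑ v ⟨w, hw, γ, hv⟩
      exact ⟨w ∘ ϑ, hT i ϑ hϑ w hw, γ, fun j => hv (ϑ j)⟩
    · rintro i v ⟨w, hw, γ, hv⟩ j j' hjj
      rw [hv, hv, hmk] at hjj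
      obtain ⟨g, hg⟩ := hjj
      have := hFa ⊥ γ⁻¹ _ _ hg
      simp only [pt, ← hamul, inv_mul_cancel, ha1] at this
      rw [mul_left_comm, inv_mul_cancel, mul_one] at this
      exact hTinj i w hw j j' (sep₂ ⊥ hbot _ _ g this)
  let act : Γ → D → D := fun γ => Quotient.map (fun y : Γ × Z => (γ * y.1, y.2))
    fun y y' H => hLact ⊥ γ y y' H
  have hact : ∀ γ y, act γ (Quotient.mk st y) = Quotient.mk st (γ * y.1, y.2) := fun _ _ => rfl
  have act_one : ∀ p, act 1 p = p := fun p => by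
    induction p using Quotient.inductionOn with
    | h y => rw [hact, one_mul]
  have act_mul : ∀ γ δ p, act (γ * δ) p = act γ (act δ p) := fun γ δ p => by
    induction p using Quotient.inductionOn with
    | h y => rw [hact, hact, hact, mul_assoc]
  have act_inv : ∀ γ p, act γ⁻¹ (act γ p) = p := fun γ p => by
    rw [← act_mul, inv_mul_cancel, act_one]
  have actG : ∀ γ t p q, G t p q → G t (act γ p) (act γ q) := fun γ t p q => by
    induction p using Quotient.inductionOn with
    | h y =>
      induction q using Quotient.inductionOn with
      | h y' =>
        rw [hact, hact, hGmk, hGmk]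
        exact Or.imp_left (hLact t γ y y')
  have actE : ∀ γ s p q, 𝔘.relE s p q → 𝔘.relE s (act γ p) (act γ q) :=
    fun γ s p q ⟨t, ht, hts, H⟩ => ⟨t, ht, hts, actG γ t p q H⟩
  have actP : ∀ γ i (p : Fin (𝔘.arity i) → D), 𝔘.relP i p → 𝔘.relP i (act γ ∘ p) := by
    rintro γ i p ⟨w, hw, δ, hp⟩
    exact ⟨w, hw, γ * δ, fun j => by rw [Function.comp_apply, hp, hact]⟩
  let c : UAct 𝔘 Γ D :=
    { act := act
      one := act_one
      mul := act_mul
      same := fun γ =>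
        { eq := fun x _ y _ => ⟨fun H => by
            have := congrArg (act γ⁻¹) H
            rwa [act_inv, act_inv] at this, fun H => congrArg (act γ) H⟩
          relE := fun s x _ y _ => ⟨fun H => by
            have := actE γ⁻¹ s _ _ H
            rwa [act_inv, act_inv] at this, actE γ s x y⟩
          relP := fun i v _ => ⟨fun H => by
            have := actP γ⁻¹ i _ H
            have e : act γ⁻¹ ∘ act γ ∘ v = id ∘ v := funext fun j => act_inv γ _
            rwa [e] at this, actP γ i v⟩ } }
  have : Finite (Γ ⧸ (powMonoidHom n : Γ →* Γ).range) :=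
    Subgroup.finiteIndex_iff_finite_quotient.1
      (Subgroup.finiteIndex_range_powMonoidHom_of_fg Γ hn.ne')
  -- The class of `(γ, z)` depends only on `z` and on the coset of `γ` modulo `n`-th powers, and
  -- these have finite index.
  have hfin : Finite D := by
    refine Finite.of_surjective
      (fun x : (Γ ⧸ (powMonoidHom n : Γ →* Γ).range) × Z =>
        (Quotient.mk st (x.1.out, x.2) : D)) fun p => ?_
    induction p using Quotient.inductionOn with
    | h y =>
      refine ⟨(QuotientGroup.mk y.1, y.2), (hmk _ _).2 ?_⟩
      obtain ⟨⟨_, g, rfl⟩, hg⟩ :=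
        QuotientGroup.mk_out_eq_mul (powMonoidHom n : Γ →* Γ).range y.1
      refine ⟨g, ?_⟩
      simp only [pt, ← hamul]
      rw [hg, mul_comm y.1]
      exact (hF ⊥).refl _
  refine ⟨D, strD, hfin, hD, c, fun z => Quotient.mk st (1, z), fun γ z z' H => ?_,
    fun z z' H => ?_, fun s z z' d hd H => ?_, fun i v => ?_⟩
  · change Quotient.mk st (1, z) = act γ (Quotient.mk st (1, z'))
    rw [hact, hmk]
    exact ⟨1, by simpa [pt, ha1] using H⟩
  · obtain ⟨g, hg⟩ := (hmk _ _).1 H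
    change F ⊥ (a 1 (h z)) (a (g ^ n) (a 1 (h z'))) at hg
    rw [ha1, ha1] at hg
    exact sep₂ ⊥ hbot _ _ g hg
  · rw [hE]
    constructor
    · rintro ⟨t, ht, hts, Ht⟩
      rcases (hGmk _ _ _).1 Ht with ⟨g, hg⟩ | Ht
      · simp only [pt, ha1] at hg
        exact ((H t).1 (sep₂ t ht _ _ g hg)).trans_lt hts
      · exact (Ht.2 d (hT₀ hd)).trans_lt hts
    · intro hds
      refine ⟨d, hT₀ hd, hds, (hGmk _ _ _).2 (Or.inl ⟨1, ?_⟩)⟩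
      simpa [pt, ha1] using (H d).2 le_rfl
  · rw [hP]
    constructor
    · rintro ⟨w, hw, γ, H⟩
      refine ⟨w, hw, sepP i v w ⟨γ, fun j => ?_⟩⟩
      obtain ⟨g, hg⟩ := (hmk _ _).1 (H j)
      exact ⟨g, by simpa only [pt, ha1, hamul] using hg⟩
    · rintro ⟨w, hw, γ, H⟩
      refine ⟨w, hw, γ, fun j => (hmk _ _).2 ⟨1, ?_⟩⟩
      simpa [pt, ha1] using H j

end Quotient

/-! ### Amalgamation of an action of `Γ` with an action of a subgroup. -/

section Amalgam

/-- If points are attached to points of `X` in a way that is compatible with an equivalence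
relation `R`, then `R` and the attachments generate the following equivalence relation. -/
lemma equivalence_attach {X Y : Type*} {l : X → X → Prop} (hl : Equivalence l)
    {R : Y → Y → Prop} (hR : Equivalence R) {Att : Y → X → Prop}
    (h₁ : ∀ y y' x, R y y' → Att y' x → Att y x)
    (h₂ : ∀ y x x', Att y x → Att y x' → l x x') :
    Equivalence fun y y' => R y y' ∨ ∃ x x', Att y x ∧ Att y' x' ∧ l x x' := by
  refine ⟨fun y => Or.inl (hR.refl y), ?_, ?_⟩
  · rintro y y' (h | ⟨x, x', hx, hx', h⟩)
    exacts [Or.inl (hR.symm h), Or.inr ⟨x', x, hx', hx, hl.symm h⟩]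
  · rintro y y' y'' (h | ⟨x, x', hx, hx', h⟩) (h' | ⟨z, z', hz, hz', h'⟩)
    · exact Or.inl (hR.trans h h')
    · exact Or.inr ⟨z, z', h₁ _ _ _ h hz, hz', h'⟩
    · exact Or.inr ⟨x, x', hx, h₁ _ _ _ (hR.symm h') hx', h⟩
    · exact Or.inr ⟨x, z', hx, hz', hl.trans h (hl.trans (h₂ _ _ _ hx' hz) h')⟩

variable {𝔘 : UTuple} {Γ : Type u} [CommGroup Γ] {X : Type*} {B : Type v} {Z : Type w}
  [𝔘.lang.Structure X] [𝔘.lang.Structure B]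

/-- Let `Γ` act on `X`, let the subgroup `Δ` act on the finite structure `B`, and let `f` be a
`Δ`-equivariant embedding of a substructure `A` of `B` into `X`. Then a given finite part `ι : Z → X`
of `X` and `B` can be amalgamated in a finite structure with an action of `Γ`. -/
lemma exists_amalgam [Group.FG Γ] (Δ : Subgroup Γ) (hX : 𝔘.IsUStructure X)
    (hB : 𝔘.IsUStructure B) [Finite B] [Finite Z] (a : UAct 𝔘 Γ X) (b : UAct 𝔘 Δ B)
    (A : Set B) (hA : ∀ δ, ∀ x ∈ A, b.act δ x ∈ A) (f : B → X) (hf : EmbOn 𝔘 f A)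
    (hfe : ∀ δ, ∀ x ∈ A, f (b.act δ x) = a.act δ (f x)) (ι : Z → X) :
    ∃ (C : Type (max u v w)) (_ : 𝔘.lang.Structure C) (_ : Finite C) (_ : 𝔘.IsUStructure C)
      (c : UAct 𝔘 Γ C) (g : Z → C) (k : B → C),
      Same 𝔘 g ι Set.univ ∧ EmbOn 𝔘 k Set.univ ∧
      (∀ γ z z', ι z = a.act γ (ι z') → g z = c.act γ (g z')) ∧
      (∀ δ x, k (b.act δ x) = c.act δ (k x)) ∧ ∀ x ∈ A, ∀ z, f x = ι z → k x = g z := by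
  classical
  -- On `Γ × B`, `R t` is the relation `d ≤ t` of the induced structure `Γ ×_Δ B`, in which `(γ * δ,
  -- e)` and `(γ, δ e)` are the same point and distinct cosets of `Δ` are unrelated. `Att t y x`
  -- says that `y` is within `t` of a point of a translate of `A` that is identified with `x`. `F t`
  -- is then `d ≤ t` in the amalgam, where paths may pass through `X`.
  let R : WithBot 𝔘.S → X ⊕ Γ × B → X ⊕ Γ × B → Prop := fun t y y' => match y, y' with
    | .inl x, .inl x' => x = x'
    | .inr y, .inr y' => ∃ δ : Δ, y.1 * δ = y'.1 ∧ lev t y.2 (b.act δ y'.2)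
    | .inl _, .inr _ => False
    | .inr _, .inl _ => False
  let Att : WithBot 𝔘.S → X ⊕ Γ × B → X → Prop := fun t y x => match y with
    | .inl x' => x' = x
    | .inr y => ∃ e ∈ A, lev t y.2 e ∧ x = a.act y.1 (f e)
  let F : WithBot 𝔘.S → X ⊕ Γ × B → X ⊕ Γ × B → Prop := fun t y y' =>
    R t y y' ∨ ∃ x x', Att t y x ∧ Att t y' x' ∧ lev t x x'
  let act : Γ → X ⊕ Γ × B → X ⊕ Γ × B := fun γ y => match y with
    | .inl x => .inl (a.act γ x)
    | .inr y => .inr (γ * y.1, y.2)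
  have eX := fun t => lev_equivalence (X := X) hX t
  have eB := fun t => lev_equivalence (X := B) hB t
  have hR : ∀ t, Equivalence (R t) := fun t => by
    refine ⟨?_, ?_, ?_⟩
    · rintro (x | y)
      · exact rfl
      · exact ⟨1, by simp, by rw [b.one]; exact (eB t).refl _⟩
    · rintro (x | y) (x' | y') h
      · exact Eq.symm h
      · exact h.elim
      · exact h.elim
      · obtain ⟨δ, h1, h2⟩ := h
        refine ⟨δ⁻¹, by simp [← h1], ?_⟩
        rw [← b.lev_act δ, b.act_inv]
        exact (eB t).symm h2
    · rintro (x | y) (x' | y') (x'' | y'') h h' <;> first | exact h.elim | exact h'.elim | skip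
      · exact Eq.trans h h'
      · obtain ⟨δ, h1, h2⟩ := h
        obtain ⟨δ', h1', h2'⟩ := h'
        refine ⟨δ * δ', by rw [← h1', ← h1, Subgroup.coe_mul, mul_assoc], ?_⟩
        rw [b.mul]
        exact (eB t).trans h2 ((b.lev_act δ t _ _).2 h2')
  have hAtt₁ : ∀ t y y' x, R t y y' → Att t y' x → Att t y x := by
    rintro t (x | y) (x' | y') z h h'
    · exact Eq.trans h h'
    · exact h.elim
    · exact h.elim
    · obtain ⟨δ, h1, h2⟩ := h
      obtain ⟨e, he, h3, rfl⟩ := h'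
      refine ⟨b.act δ e, hA δ e he, (eB t).trans h2 ((b.lev_act δ t _ _).2 h3), ?_⟩
      rw [hfe δ e he, ← a.mul, h1]
  have hAtt₂ : ∀ t y x x', Att t y x → Att t y x' → lev t x x' := by
    rintro t (x | y) z z' h h'
    · obtain rfl : x = z := h
      obtain rfl : x = z' := h'
      exact (eX t).refl _
    · obtain ⟨e, he, h1, rfl⟩ := h
      obtain ⟨e', he', h1', rfl⟩ := h'
      rw [a.lev_act, hf.lev_iff t he he']
      exact (eB t).trans ((eB t).symm h1) h1'
  have hF : ∀ t, Equivalence (F t) := fun t =>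
    equivalence_attach (eX t) (hR t) (hAtt₁ t) (hAtt₂ t)
  have hRmono : ∀ t u, t ≤ u → ∀ y y', R t y y' → R u y y' := by
    rintro t u htu (x | y) (x' | y') h
    · exact h
    · exact h.elim
    · exact h.elim
    · obtain ⟨δ, h1, h2⟩ := h
      exact ⟨δ, h1, lev_mono htu h2⟩
  have hAmono : ∀ t u, t ≤ u → ∀ y x, Att t y x → Att u y x := by
    rintro t u htu (x | y) x' h
    · exact h
    · obtain ⟨e, he, h1, h2⟩ := h
      exact ⟨e, he, lev_mono htu h1, h2⟩
  have hRa : ∀ t γ y y', R t y y' → R t (act γ y) (act γ y') := by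
    rintro t γ (x | y) (x' | y') h
    · exact congrArg (a.act γ) h
    · exact h.elim
    · exact h.elim
    · obtain ⟨δ, h1, h2⟩ := h
      exact ⟨δ, by simp only [← h1, mul_assoc], h2⟩
  have hAa : ∀ t γ y x, Att t y x → Att t (act γ y) (a.act γ x) := by
    rintro t γ (x | y) x' h
    · exact congrArg (a.act γ) h
    · obtain ⟨e, he, h1, rfl⟩ := h
      exact ⟨e, he, h1, (a.mul _ _ _).symm⟩
  have hXX : ∀ t x x', F t (.inl x) (.inl x') ↔ lev t x x' := fun t x x' => by
    constructor
    · rintro (h | ⟨z, z', h1, h2, h⟩)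
      · obtain rfl : x = x' := h
        exact (eX t).refl _
      · obtain rfl : x = z := h1
        obtain rfl : x' = z' := h2
        exact h
    · exact fun h => Or.inr ⟨x, x', rfl, rfl, h⟩
  have hXB : ∀ x γ e, F ⊥ (.inl x) (.inr (γ, e)) → e ∈ A ∧ x = a.act γ (f e) := by
    rintro x γ e (h | ⟨z, z', h1, ⟨e', he', h2, rfl⟩, h⟩)
    · exact h.elim
    · obtain rfl : x = z := h1
      obtain rfl := (lev_bot hB _ _).1 h2
      exact ⟨he', (lev_bot hX _ _).1 h⟩
  have hBB : ∀ γ e e', F ⊥ (.inr (1, e)) (.inr (γ, e')) →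
      (∃ δ : Δ, (δ : Γ) = γ ∧ e = b.act δ e') ∨ (e ∈ A ∧ e' ∈ A ∧ f e = a.act γ (f e')) := by
    rintro γ e e' (⟨δ, h1, h2⟩ | ⟨z, z', ⟨d, hd, h1, rfl⟩, ⟨d', hd', h2, rfl⟩, h⟩)
    · exact Or.inl ⟨δ, by simpa using h1, (lev_bot hB _ _).1 h2⟩
    · obtain rfl := (lev_bot hB _ _).1 h1
      obtain rfl := (lev_bot hB _ _).1 h2
      refine Or.inr ⟨hd, hd', ?_⟩
      rw [lev_bot hX, a.one] at h
      exact h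
  -- A detour through `X` enters and leaves at points of `A`, where `f` preserves distances, so the
  -- ultrametric inequality in `B` shows that it is no shorter.
  have hBB₁ : ∀ t e e', F t (.inr (1, e)) (.inr (1, e')) ↔ lev t e e' := fun t e e' => by
    constructor
    · rintro (⟨δ, h1, h2⟩ | ⟨z, z', ⟨d, hd, h1, rfl⟩, ⟨d', hd', h2, rfl⟩, h⟩)
      · obtain rfl : δ = 1 := by simpa using h1
        rwa [b.one] at h2
      · rw [a.lev_act, hf.lev_iff t hd hd'] at h
        exact (eB t).trans h1 ((eB t).trans h ((eB t).symm h2))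
    · exact fun h => Or.inl ⟨1, by simp, by rwa [b.one]⟩
  let h : Z ⊕ B → X ⊕ Γ × B := Sum.elim (fun z => .inl (ι z)) (fun e => .inr (1, e))
  -- The amalgam is free: the relations `P i` come from `X` or from `B` alone.
  let T : ∀ i : Fin 𝔘.r, Set (Fin (𝔘.arity i) → Z ⊕ B) := fun i =>
    {v | (∃ w, 𝔘.relP i (ι ∘ w) ∧ v = Sum.inl ∘ w) ∨ ∃ w, 𝔘.relP i w ∧ v = Sum.inr ∘ w}
  obtain ⟨T₁, hT₁⟩ := exists_finset_dist hX ι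
  obtain ⟨T₂, hT₂⟩ := exists_finset_dist hB (id : B → B)
  obtain ⟨C, strC, finC, hC, c, q, hq1, hq2, hq3, hq4⟩ := exists_finite_quotient act
    (by rintro (x | y)
        · exact congrArg Sum.inl (a.one x)
        · exact congrArg Sum.inr (Prod.ext (one_mul _) rfl))
    (by rintro γ δ (x | y)
        · exact congrArg Sum.inl (a.mul γ δ x)
        · exact congrArg Sum.inr (Prod.ext (mul_assoc _ _ _) rfl))
    F hF
    (by rintro t u htu y y' (h | ⟨x, x', h1, h2, h⟩)
        · exact Or.inl (hRmono t u htu _ _ h)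
        · exact Or.inr ⟨x, x', hAmono t u htu _ _ h1, hAmono t u htu _ _ h2, lev_mono htu h⟩)
    (by rintro t γ y y' (h | ⟨x, x', h1, h2, h⟩)
        · exact Or.inl (hRa t γ _ _ h)
        · exact Or.inr ⟨_, _, hAa t γ _ _ h1, hAa t γ _ _ h2, (a.lev_act γ t _ _).2 h⟩)
    h T
    (by rintro i ϑ hϑ v (⟨w, hw, rfl⟩ | ⟨w, hw, rfl⟩)
        · exact Or.inl ⟨w ∘ ϑ, (hX.symm i ϑ hϑ _).2 hw, rfl⟩
        · exact Or.inr ⟨w ∘ ϑ, (hB.symm i ϑ hϑ _).2 hw, rfl⟩)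
    (by rintro i v (⟨w, hw, rfl⟩ | ⟨w, hw, rfl⟩) j j' hjj
        · exact hX.distinct i _ hw ((lev_bot hX _ _).1 ((hXX ⊥ _ _).1 hjj))
        · exact hB.distinct i _ hw ((lev_bot hB _ _).1 ((hBB₁ ⊥ _ _).1 hjj)))
    (T₁ ∪ T₂)
  have hr : ∀ y γ e, F ⊥ y (act γ (h (.inr e))) ↔ F ⊥ y (.inr (γ, e)) := fun y γ e => by
    have : act γ (h (.inr e)) = .inr (γ, e) := congrArg Sum.inr (Prod.ext (mul_one _) rfl)
    rw [this]
  have kXX : ∀ z γ z', F ⊥ (h (.inl z)) (act γ (h (.inl z'))) ↔ ι z = a.act γ (ι z') :=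
    fun z γ z' => (hXX ⊥ _ _).trans (lev_bot hX _ _)
  have kXB : ∀ z γ e, F ⊥ (h (.inl z)) (act γ (h (.inr e))) → e ∈ A ∧ ι z = a.act γ (f e) :=
    fun z γ e H => hXB (ι z) γ e ((hr (h (.inl z)) γ e).1 H)
  have kBX : ∀ e γ z, F ⊥ (h (.inr e)) (act γ (h (.inl z))) → e ∈ A ∧ a.act γ (ι z) = f e :=
    fun e γ z H => by
      have H' : F ⊥ (act γ (h (.inl z))) (h (.inr e)) :=
        @Equivalence.symm _ _ (hF ⊥) (h (.inr e)) (act γ (h (.inl z))) H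
      have := hXB (a.act γ (ι z)) 1 e H'
      rwa [a.one] at this
  have kBB : ∀ e γ e', F ⊥ (h (.inr e)) (act γ (h (.inr e'))) →
      (∃ δ : Δ, (δ : Γ) = γ ∧ e = b.act δ e') ∨ (e ∈ A ∧ e' ∈ A ∧ f e = a.act γ (f e')) :=
    fun e γ e' H => hBB γ e e' ((hr (h (.inr e)) γ e').1 H)
  have kΔ : ∀ e (δ : Δ) e', e = b.act δ e' → F ⊥ (h (.inr e)) (act δ (h (.inr e'))) :=
    fun e δ e' H => (hr (h (.inr e)) δ e').2 (Or.inl ⟨δ, one_mul _, (lev_bot hB _ _).2 H⟩)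
  refine ⟨C, strC, finC, hC, c, q ∘ Sum.inl, q ∘ Sum.inr, ⟨?_, ?_, ?_⟩, ⟨?_, ?_, ?_⟩,
    ?_, ?_, ?_⟩
  · refine fun z _ z' _ => ⟨fun H => (lev_bot hX _ _).1 ((hXX ⊥ _ _).1 (hq2 _ _ H)), fun H => ?_⟩
    have := hq1 1 (Sum.inl z) (Sum.inl z') ((kXX _ _ _).2 (by rwa [a.one]))
    rwa [c.one] at this
  · intro s z _ z' _
    obtain ⟨d, hd, h1, h2⟩ := hT₁ s z z'
    rw [h2]
    exact hq3 s _ _ d (Finset.mem_union_left _ hd) fun t => (hXX t _ _).trans (h1 t)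
  · intro i v _
    refine (hq4 i (Sum.inl ∘ v)).trans ⟨?_, fun H => ?_⟩
    · rintro ⟨w, ⟨w, hw, rfl⟩ | ⟨w, hw, rfl⟩, γ, H⟩
      · have e : (fun j => a.act γ ((ι ∘ w) j)) = ι ∘ v := funext fun j => ((kXX _ _ _).1 (H j)).symm
        rw [← e, a.relP_act]
        exact hw
      · have e : ∀ j, w j ∈ A ∧ ι (v j) = a.act γ (f (w j)) := fun j =>
          kXB _ _ _ (H j)
        have e' : (fun j => a.act γ ((f ∘ w) j)) = ι ∘ v := funext fun j => (e j).2.symm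
        rw [← e', a.relP_act, hf.relP i w fun j => (e j).1]
        exact hw
    · refine ⟨Sum.inl ∘ v, Or.inl ⟨v, H, rfl⟩, 1, fun j => ?_⟩
      exact (kXX _ _ _).2 (a.one _).symm
  · refine fun z _ z' _ => ⟨fun H => (lev_bot hB _ _).1 ((hBB₁ ⊥ _ _).1 (hq2 _ _ H)), ?_⟩
    rintro rfl
    rfl
  · intro s z _ z' _
    obtain ⟨d, hd, h1, h2⟩ := hT₂ s z z'
    rw [h2]
    exact hq3 s _ _ d (Finset.mem_union_right _ hd) fun t => (hBB₁ t _ _).trans (h1 t)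
  · intro i v _
    refine (hq4 i (Sum.inr ∘ v)).trans ⟨?_, fun H => ?_⟩
    · rintro ⟨w, ⟨w, hw, rfl⟩ | ⟨w, hw, rfl⟩, γ, H⟩
      · have e : ∀ j, v j ∈ A ∧ a.act γ (ι (w j)) = f (v j) := fun j => kBX _ _ _ (H j)
        have e' : (fun j => a.act γ ((ι ∘ w) j)) = f ∘ v := funext fun j => (e j).2
        rw [← a.relP_act γ, e'] at hw
        exact (hf.relP i v fun j => (e j).1).1 hw
      · have e : ∀ j, (∃ δ : Δ, (δ : Γ) = γ ∧ v j = b.act δ (w j)) ∨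
            (v j ∈ A ∧ w j ∈ A ∧ f (v j) = a.act γ (f (w j))) := fun j =>
          kBB _ _ _ (H j)
        -- If `γ ∈ Δ`, then `v` is the translate of `w` inside `B`: entries identified through `X`
        -- agree because `f` is equivariant and injective on `A`. Otherwise every entry is
        -- identified through `X`, so both tuples lie in `A` and the relation can be transported in
        -- `X`.
        by_cases hγ : γ ∈ Δ
        · have e' : (fun j => b.act ⟨γ, hγ⟩ (w j)) = v := funext fun j => by
            rcases e j with ⟨δ, rfl, h2⟩ | ⟨h1, h2, h3⟩
            · exact h2.symm
            · exact (hf.eq _ (hA _ _ h2) _ h1).1 ((hfe _ _ h2).trans h3.symm)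
          change 𝔘.relP i v
          rw [← e', b.relP_act]
          exact hw
        · have e' : ∀ j, v j ∈ A ∧ w j ∈ A ∧ f (v j) = a.act γ (f (w j)) := fun j =>
            (e j).resolve_left fun ⟨δ, h1, _⟩ => hγ (h1 ▸ δ.2)
          have h1 := (hf.relP i w fun j => (e' j).2.1).2 hw
          rw [← a.relP_act γ] at h1
          have h2 : (fun j => a.act γ ((f ∘ w) j)) = f ∘ v := funext fun j => (e' j).2.2.symm
          rw [h2] at h1
          exact (hf.relP i v fun j => (e' j).1).1 h1
    · refine ⟨Sum.inr ∘ v, Or.inr ⟨v, H, rfl⟩, 1, fun j => ?_⟩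
      exact kΔ _ 1 _ (b.one _).symm
  · exact fun γ z z' H => hq1 γ _ _ ((kXX _ _ _).2 H)
  · exact fun δ x => hq1 δ _ _ (kΔ _ δ _ rfl)
  · intro x hx z hxz
    have := hq1 1 (Sum.inr x) (Sum.inl z) (by
      change F ⊥ (h (.inr x)) (.inl (a.act 1 (ι z)))
      rw [a.one]
      exact Or.inr ⟨f x, ι z, ⟨x, hx, (eB ⊥).refl _, (a.one _).symm⟩, rfl,
        (lev_bot hX _ _).2 hxz⟩)
    rwa [c.one] at this

end Amalgam

/-! ### The extension property of `𝐔` and representations as actions. -/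

section Space

variable {𝔘 : UTuple}

lemma nonempty_equiv_model (𝔘 : UTuple) : Nonempty (𝔘.Space ≃[𝔘.lang] Model.Pt 𝔘) :=
  have : FirstOrder.Language.Structure.CG 𝔘.lang 𝔘.Space :=
    FirstOrder.Language.Structure.cg_of_countable
  have : FirstOrder.Language.Structure.CG 𝔘.lang (Model.Pt 𝔘) :=
    FirstOrder.Language.Structure.cg_of_countable
  𝔘.isFraisseLimit_space.nonempty_equiv (Model.isFraisseLimit 𝔘)

lemma isUStructure_space (𝔘 : UTuple) : 𝔘.IsUStructure 𝔘.Space :=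
  Model.isUStructure_of_embedding (Model.isUStructure 𝔘) (𝔘.nonempty_equiv_model.some.toEmbedding)

instance nonempty_space : Nonempty 𝔘.Space :=
  ⟨𝔘.nonempty_equiv_model.some.symm ((0 : Model.T 𝔘 →₀ ℕ) : Model.Pt 𝔘)⟩

/-- The extension property of `𝐔`. -/
lemma exists_embOn_extend {B : Type*} [𝔘.lang.Structure B] [Finite B] (hB : 𝔘.IsUStructure B)
    (f : B → 𝔘.Space) (A : Set B) (hf : EmbOn 𝔘 f A) :
    ∃ g : B → 𝔘.Space, EmbOn 𝔘 g Set.univ ∧ ∀ x ∈ A, g x = f x := by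
  classical
  obtain ⟨φ⟩ := 𝔘.nonempty_equiv_model
  have hφ : EmbOn 𝔘 φ Set.univ := embOn_of_embedding φ.toEmbedding
  have hψ : EmbOn 𝔘 φ.symm Set.univ := embOn_of_embedding φ.symm.toEmbedding
  have h0 : EmbOn 𝔘 (φ ∘ f) A := (hφ.comp f fun _ _ => trivial).trans hf
  have := Fintype.ofFinite B
  obtain ⟨g, hg, hgp⟩ := Model.extend_finset hB (φ ∘ f) A.toFinset
    (by rw [Set.coe_toFinset]
        exact ⟨fun x hx y hy => (h0.eq x hx y hy).1, h0.relE, h0.relP⟩) Finset.univ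
  have hg' : EmbOn 𝔘 g Set.univ :=
    ⟨fun x _ y _ => ⟨fun h => hgp.inj (by simp) (by simp) h, fun h => congrArg g h⟩,
      fun s x _ y _ => hgp.relE s x (by simp) y (by simp), fun i v _ => hgp.relP i v (by simp)⟩
  refine ⟨φ.symm ∘ g, (hψ.comp g fun _ _ => trivial).trans hg', fun x hx => ?_⟩
  rw [Function.comp_apply, hg x (by simpa using hx)]
  exact φ.symm_apply_apply _

/-- On `A` the map `f` factors through `k`, and the factor is an embedding of `k '' A`, which
extends to `B`. The index type `T` allows the prescribed part of `B` to be given by any family of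
points. -/
lemma exists_embOn_lift {T B : Type*} [𝔘.lang.Structure B] [Finite B] (hB : 𝔘.IsUStructure B)
    (k : T → B) (f : T → 𝔘.Space) (A : Set T) (h : Same 𝔘 k f A) :
    ∃ g : B → 𝔘.Space, EmbOn 𝔘 g Set.univ ∧ ∀ t ∈ A, g (k t) = f t := by
  classical
  have hex : ∀ b : B, ∃ y : 𝔘.Space, ∀ t ∈ A, k t = b → f t = y := fun b => by
    by_cases hb : ∃ t ∈ A, k t = b
    · obtain ⟨t, ht, rfl⟩ := hb
      exact ⟨f t, fun t' ht' htt => (h.eq t' ht' t ht).1 htt⟩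
    · exact ⟨Classical.arbitrary _, fun t ht htb => absurd ⟨t, ht, htb⟩ hb⟩
  choose f' hf' using hex
  have hsec : ∀ b : B, b ∈ k '' A → ∃ t ∈ A, k t = b := fun b hb => hb
  have hT : (k '' A).Nonempty → Nonempty T := fun ⟨_, t, _⟩ => ⟨t⟩
  have hemb : EmbOn 𝔘 f' (k '' A) := by
    by_cases hne : (k '' A).Nonempty
    · have := hT hne
      choose! u hu hku using hsec
      refine (h.symm.comp u hu).congr (fun b hb => ?_) fun b hb => (hku b hb).symm
      exact (hf' b (u b) (hu b hb) (hku b hb)).symm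
    · rw [Set.not_nonempty_iff_eq_empty] at hne
      rw [hne]
      exact ⟨fun _ hx => hx.elim, fun _ _ hx => hx.elim,
        fun i v hv => (hv ⟨0, 𝔘.arity_pos i⟩).elim⟩
  obtain ⟨g, hg, hgf⟩ := exists_embOn_extend hB f' _ hemb
  exact ⟨g, hg, fun t ht => (hgf _ ⟨t, ht, rfl⟩).trans (hf' _ t ht rfl).symm⟩

section Rep

variable {Γ : Type*} [Group Γ]

/-- The action on `𝐔` given by a representation. -/
noncomputable def repAct (π : GroupRep Γ 𝔘.Aut) : UAct 𝔘 Γ 𝔘.Space where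
  act γ x := π.eval γ x
  one x := by
    have : π.eval 1 = 1 := MonoidHom.map_one (π : Γ →* 𝔘.Aut)
    rw [this]; rfl
  mul γ δ x := by
    have : π.eval (γ * δ) = π.eval γ * π.eval δ := MonoidHom.map_mul (π : Γ →* 𝔘.Aut) γ δ
    rw [this]; rfl
  same γ := embOn_of_embedding
    (FirstOrder.Language.Equiv.toEmbedding (L := 𝔘.lang) (M := 𝔘.Space) (N := 𝔘.Space) (π.eval γ))

/-- An action by automorphisms as an isomorphism. -/
def UAct.toAut (a : UAct 𝔘 Γ 𝔘.Space) (γ : Γ) : 𝔘.Aut :=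
  { toFun := a.act γ
    invFun := a.act γ⁻¹
    left_inv := a.inv_act γ
    right_inv := a.act_inv γ
    map_fun' := fun {_} F => Empty.elim F
    map_rel' := (a.same γ).toEmbedding.map_rel' : 𝔘.Space ≃[𝔘.lang] 𝔘.Space }

lemma aut_ext {g h : 𝔘.Aut} (H : ∀ x, g x = h x) : g = h :=
  FirstOrder.Language.Equiv.ext H

/-- The representation given by an action on `𝐔`. -/
noncomputable def UAct.toRep (a : UAct 𝔘 Γ 𝔘.Space) : GroupRep Γ 𝔘.Aut :=
  ({ toFun := a.toAut
     map_one' := aut_ext a.one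
     map_mul' := fun γ δ => aut_ext (a.mul γ δ) } : Γ →* 𝔘.Aut)

lemma rep_ext {π θ : GroupRep Γ 𝔘.Aut}
    (h : ∀ γ x, (repAct π).act γ x = (repAct θ).act γ x) : π = θ :=
  MonoidHom.ext (f := (π : Γ →* 𝔘.Aut)) fun γ => aut_ext (h γ)

end Rep

/-! ### Finite actions extend to `𝐔` -/

section Stage

variable {Γ : Type*} [Group Γ]

variable (𝔘 Γ) in
/-- Finite substructures of `𝐔` with an action of `Γ`. -/
structure Stage where
  carrier : Finset 𝔘.Space
  uact : UAct 𝔘 Γ {x // x ∈ carrier}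

instance : Preorder (Stage 𝔘 Γ) where
  le p q := ∃ h : p.carrier ⊆ q.carrier, ∀ γ x, (q.uact.act γ ⟨x.1, h x.2⟩).1 = (p.uact.act γ x).1
  le_refl p := ⟨subset_rfl, fun _ _ => rfl⟩
  le_trans p q r := by
    rintro ⟨h, H⟩ ⟨h', H'⟩
    refine ⟨h.trans h', fun γ x => ?_⟩
    rw [← H γ x, ← H' γ]

lemma exists_stage {D : Type*} [𝔘.lang.Structure D] [Finite D] (d : UAct 𝔘 Γ D)
    (g : D → 𝔘.Space) (hg : EmbOn 𝔘 g Set.univ) :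
    ∃ p : Stage 𝔘 Γ, ∃ h : ∀ x, g x ∈ p.carrier, ∀ γ x,
      (p.uact.act γ ⟨g x, h x⟩).1 = g (d.act γ x) := by
  classical
  have := Fintype.ofFinite D
  have hinj : Function.Injective g := fun x y h => (hg.eq x trivial y trivial).1 h
  let e : D ≃ {x // x ∈ Finset.univ.image g} :=
    Equiv.ofBijective (fun x => ⟨g x, Finset.mem_image_of_mem g (Finset.mem_univ x)⟩)
      ⟨fun x y h => hinj (Subtype.ext_iff.1 h), fun ⟨y, hy⟩ => by
        obtain ⟨x, -, hx⟩ := Finset.mem_image.1 hy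
        exact ⟨x, Subtype.ext hx⟩⟩
  have he : EmbOn 𝔘 e Set.univ :=
    ⟨fun x _ y _ => e.injective.eq_iff, fun s x _ y _ => hg.relE s x trivial y trivial,
      fun i v _ => hg.relP i v fun _ => trivial⟩
  refine ⟨⟨_, d.transport e he⟩, fun x => (e x).2, fun γ x => ?_⟩
  change (e (d.act γ (e.symm (e x)))).1 = _
  rw [e.symm_apply_apply]
  rfl

end Stage

/-- To add `x`, the stage is amalgamated with its union with `x`, over the stage and with the
trivial subgroup: independent copies of `x`, one for each element of `Γ`, are adjoined, and a finite
quotient is taken. The quotient embeds in `𝐔` with `x` and the stage fixed. -/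
lemma Stage.isCofinal {Γ : Type*} [CommGroup Γ] [Group.FG Γ] (x : 𝔘.Space) :
    IsCofinal {p : Stage 𝔘 Γ | x ∈ p.carrier} := by
  classical
  intro p
  rcases p.carrier.eq_empty_or_nonempty with hp | hp
  · obtain ⟨q, hq, -⟩ := exists_stage (UAct.trivialAct 𝔘 {y // y ∈ ({x} : Finset 𝔘.Space)} Γ)
      Subtype.val (embOn_subtype_val _)
    refine ⟨q, hq ⟨x, by simp⟩, by simp [hp], fun γ y => ?_⟩
    exact absurd y.2 (by simp [hp])
  · let B := {y // y ∈ insert x p.carrier}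
    have hB : 𝔘.IsUStructure B := isUStructure_of_embOn 𝔘.isUStructure_space (embOn_subtype_val _)
    have hX : 𝔘.IsUStructure {y // y ∈ p.carrier} :=
      isUStructure_of_embOn 𝔘.isUStructure_space (embOn_subtype_val _)
    -- The value of `f` outside the carrier is irrelevant, but one is needed; hence the separate
    -- treatment of the empty stage.
    let f : B → {y // y ∈ p.carrier} := fun b =>
      if h : b.1 ∈ p.carrier then ⟨b.1, h⟩ else ⟨_, hp.choose_spec⟩
    have hf : ∀ b : B, b.1 ∈ p.carrier → (f b).1 = b.1 := fun b hb => by simp [f, hb]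
    have hf' : EmbOn 𝔘 f {b | b.1 ∈ p.carrier} :=
      ((((embOn_subtype_val _).comp f fun _ _ => trivial).symm.congr
        (fun _ _ => rfl) fun b hb => (hf b hb).symm)).trans
        ((embOn_subtype_val _).mono (Set.subset_univ _))
    obtain ⟨C, strC, finC, hC, c, g, k, hg, hk, hgc, -, hkg⟩ :=
      exists_amalgam (⊥ : Subgroup Γ) hX hB p.uact (UAct.trivialAct 𝔘 B _)
        {b | b.1 ∈ p.carrier} (fun _ _ h => h) f hf'
        (fun δ b _ => by
          obtain rfl : δ = 1 := Subsingleton.elim _ _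
          exact (p.uact.one _).symm) id
    obtain ⟨u, hu, huk⟩ := exists_embOn_lift hC k Subtype.val Set.univ
      (hk.trans (embOn_subtype_val _).symm)
    have hug : ∀ y, u (g y) = y.1 := fun y => by
      have h1 : y.1 ∈ insert x p.carrier := Finset.mem_insert_of_mem y.2
      rw [← hkg ⟨y.1, h1⟩ y.2 y (Subtype.ext (hf ⟨y.1, h1⟩ y.2)), huk _ trivial]
    obtain ⟨q, hq, hqa⟩ := exists_stage c u hu
    refine ⟨q, ?_, fun y hy => ?_, fun γ y => ?_⟩
    · have := hq (k ⟨x, Finset.mem_insert_self _ _⟩)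
      rwa [huk _ trivial] at this
    · have := hq (g ⟨y, hy⟩)
      rwa [hug] at this
    · have h1 := hqa γ (g y)
      rw [← hgc γ (p.uact.act γ y) y rfl] at h1
      rw [← (h1.trans (hug _))]
      exact congrArg (fun z => (q.uact.act γ z).1) (Subtype.ext (hug y).symm)

/-- A chain of stages that starts with `p` and meets all the cofinal sets `Stage.isCofinal x` has an
action on all of `𝐔` as its union. -/
lemma Stage.exists_rep {Γ : Type*} [CommGroup Γ] [Group.FG Γ] (p : Stage 𝔘 Γ) :
    ∃ π : GroupRep Γ 𝔘.Aut, ∀ γ x, (repAct π).act γ x.1 = (p.uact.act γ x).1 := by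
  classical
  have := Encodable.ofCountable 𝔘.Space
  let 𝒟 : 𝔘.Space → Order.Cofinal (Stage 𝔘 Γ) := fun x => ⟨_, Stage.isCofinal x⟩
  let s := Order.sequenceOfCofinals p 𝒟
  have hs : Monotone s := Order.sequenceOfCofinals.monotone p 𝒟
  have hsub : ∀ m n, m ≤ n → (s m).carrier ⊆ (s n).carrier := fun m n h => (hs h).1
  -- Stage `0` of the chain is `p`, and the requirement with code `m` is met at stage `m + 1`.
  let N : 𝔘.Space → ℕ := fun x => Encodable.encode x + 1
  have hN : ∀ n x, N x ≤ n → x ∈ (s n).carrier := fun n x h =>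
    hsub _ _ h (Order.sequenceOfCofinals.encode_mem p 𝒟 x)
  let act : Γ → 𝔘.Space → 𝔘.Space := fun γ x => ((s (N x)).uact.act γ ⟨x, hN _ x le_rfl⟩).1
  have hact : ∀ n γ x (hx : x ∈ (s n).carrier), act γ x = ((s n).uact.act γ ⟨x, hx⟩).1 := by
    intro n γ x hx
    rcases le_total n (N x) with h | h
    · exact (hs h).2 γ ⟨x, hx⟩
    · exact ((hs h).2 γ ⟨x, hN _ x le_rfl⟩).symm
  have hone : ∀ x, act 1 x = x := fun x => congrArg Subtype.val ((s (N x)).uact.one _)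
  have hmul : ∀ γ δ x, act (γ * δ) x = act γ (act δ x) := fun γ δ x => by
    rw [hact (N x) γ (act δ x) (((s (N x)).uact.act δ ⟨x, hN _ x le_rfl⟩).2)]
    exact congrArg Subtype.val ((s (N x)).uact.mul γ δ _)
  have hinv : ∀ γ x, act γ⁻¹ (act γ x) = x := fun γ x => by
    rw [← hmul, inv_mul_cancel, hone]
  let a : UAct 𝔘 Γ 𝔘.Space :=
    { act := act
      one := hone
      mul := hmul
      same := fun γ =>
        { eq := fun x _ y _ => ⟨fun h => by
            have := congrArg (act γ⁻¹) h
            rwa [hinv, hinv] at this, fun h => congrArg _ h⟩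
          relE := fun t x _ y _ => by
            have hx := hN (max (N x) (N y)) x (le_max_left _ _)
            have hy := hN (max (N x) (N y)) y (le_max_right _ _)
            rw [hact _ γ x hx, hact _ γ y hy]
            exact (s (max (N x) (N y))).uact.relE_act γ t ⟨x, hx⟩ ⟨y, hy⟩
          relP := fun i v _ => by
            have hv : ∀ j, v j ∈ (s (Finset.univ.sup fun j => N (v j))).carrier := fun j =>
              hN _ _ (Finset.le_sup (f := fun j => N (v j)) (Finset.mem_univ j))
            have e : act γ ∘ v = fun j =>
                ((s (Finset.univ.sup fun j => N (v j))).uact.act γ ⟨v j, hv j⟩).1 :=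
              funext fun j => hact _ γ (v j) (hv j)
            rw [e]
            exact (s _).uact.relP_act γ i fun j => ⟨v j, hv j⟩ } }
  exact ⟨a.toRep, fun γ x => hact 0 γ x.1 x.2⟩

/-- Finite structures with an action of `Γ` embed equivariantly in `𝐔`, with respect to some
representation, in such a way that the embedding is prescribed on a part of the structure. -/
lemma exists_rep_lift {Γ : Type*} [CommGroup Γ] [Group.FG Γ] {T D : Type*} [𝔘.lang.Structure D]
    [Finite D] (hD : 𝔘.IsUStructure D) (d : UAct 𝔘 Γ D) (k : T → D) (f : T → 𝔘.Space)
    (h : Same 𝔘 k f Set.univ) :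
    ∃ (π : GroupRep Γ 𝔘.Aut) (g : D → 𝔘.Space), EmbOn 𝔘 g Set.univ ∧ (∀ t, g (k t) = f t) ∧
      ∀ γ x, g (d.act γ x) = (repAct π).act γ (g x) := by
  obtain ⟨g, hg, hgk⟩ := exists_embOn_lift hD k f _ h
  obtain ⟨p, hp, hpa⟩ := exists_stage d g hg
  obtain ⟨π, hπ⟩ := p.exists_rep
  exact ⟨π, g, hg, fun t => hgk t trivial, fun γ x => ((hπ γ ⟨g x, hp x⟩).trans (hpa γ x)).symm⟩

end Space

variable {𝔘 : UTuple}

/-! ### Representations with finite orbits and the extension property -/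

section Rich

variable {Γ : Type*} [Group Γ]

/-- The extension property of the representation `π` with respect to a finite substructure with an
action of `Γ` and a part of it on which the action is given by `π`. -/
def ExtendsStage (π : GroupRep Γ 𝔘.Aut) (p : Stage 𝔘 Γ) (A : Finset 𝔘.Space) : Prop :=
  (∀ γ x, x.1 ∈ A → (p.uact.act γ x).1 ∈ A) →
  (∀ γ x, x.1 ∈ A → (repAct π).act γ x.1 = (p.uact.act γ x).1) →
  ∃ k : {x // x ∈ p.carrier} → 𝔘.Space, EmbOn 𝔘 k Set.univ ∧ (∀ x, x.1 ∈ A → k x = x.1) ∧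
    ∀ γ x, k (p.uact.act γ x) = (repAct π).act γ (k x)

/-- The finite set `A` is contained in a finite invariant set. -/
def HasFiniteHull (π : GroupRep Γ 𝔘.Aut) (A : Finset 𝔘.Space) : Prop :=
  ∃ A' : Finset 𝔘.Space, A ⊆ A' ∧ ∀ γ, ∀ x ∈ A', (repAct π).act γ x ∈ A'

/-- Representations all of whose orbits are finite and which have the extension property with
respect to finite structures with an action of `Γ`. -/
structure Rich (π : GroupRep Γ 𝔘.Aut) : Prop where
  hull : ∀ A, HasFiniteHull π A
  ext : ∀ p A, ExtendsStage π p A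

/-- `Rich` speaks only of substructures of `𝐔`, so as to consist of countably many conditions.
Copying `C` into `𝐔` over the prescribed part gives the same property for arbitrary finite
structures with an action. -/
lemma Rich.exists_lift {π : GroupRep Γ 𝔘.Aut} (hπ : Rich π) {T C : Type*} [𝔘.lang.Structure C]
    [Finite C] (hC : 𝔘.IsUStructure C) (c : UAct 𝔘 Γ C) (j : T → C) (f : T → 𝔘.Space)
    (h : Same 𝔘 j f Set.univ)
    (heq : ∀ γ t, ∃ t', c.act γ (j t) = j t' ∧ (repAct π).act γ (f t) = f t') :
    ∃ u : C → 𝔘.Space, EmbOn 𝔘 u Set.univ ∧ (∀ t, u (j t) = f t) ∧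
      ∀ γ x, u (c.act γ x) = (repAct π).act γ (u x) := by
  classical
  obtain ⟨g, hg, hgj⟩ := exists_embOn_lift hC j f _ h
  obtain ⟨p, hp, hpa⟩ := exists_stage c g hg
  have hfin : (Set.range f).Finite := by
    refine (Set.finite_range g).subset ?_
    rintro _ ⟨t, rfl⟩
    exact ⟨j t, hgj t trivial⟩
  have hsub : ∀ (t) (x : {x // x ∈ p.carrier}), f t = x.1 → x = ⟨g (j t), hp _⟩ := fun t x hx =>
    Subtype.ext (hx.symm.trans (hgj t trivial).symm)
  obtain ⟨k, hk, hkA, hka⟩ := hπ.ext p hfin.toFinset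
    (by
      intro γ x hx
      obtain ⟨t, ht⟩ := hfin.mem_toFinset.1 hx
      obtain ⟨t', h1, h2⟩ := heq γ t
      rw [hsub t x ht, hpa, h1, hgj _ trivial]
      exact hfin.mem_toFinset.2 ⟨t', rfl⟩)
    (by
      intro γ x hx
      obtain ⟨t, ht⟩ := hfin.mem_toFinset.1 hx
      obtain ⟨t', h1, h2⟩ := heq γ t
      rw [← ht, h2, hsub t x ht, hpa, h1, hgj _ trivial])
  refine ⟨fun x => k ⟨g x, hp x⟩, ?_, fun t => ?_, fun γ x => ?_⟩
  · refine ((hk.trans (embOn_subtype_val _).symm).comp (fun x => (⟨g x, hp x⟩ : {x // _}))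
      fun _ _ => trivial).trans ?_
    exact hg
  · exact (hkA ⟨g (j t), hp _⟩ (hfin.mem_toFinset.2 ⟨t, (hgj t trivial).symm⟩)).trans
      (hgj t trivial)
  · rw [← hka]
    exact congrArg k (Subtype.ext (hpa γ x).symm)

end Rich

/-- Representations are approximated by representations with a given instance of the extension
property and a finite invariant set containing a given finite set. -/
lemma exists_rep_approx {Γ : Type*} [CommGroup Γ] [Group.FG Γ] (π : GroupRep Γ 𝔘.Aut)
    (I : Finset Γ) (C : Finset 𝔘.Space) (p : Stage 𝔘 Γ) (A : Finset 𝔘.Space)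
    (hA : ∀ γ x, x.1 ∈ A → (p.uact.act γ x).1 ∈ A)
    (hp : ∀ γ x, x.1 ∈ A → (repAct π).act γ x.1 = (p.uact.act γ x).1) :
    ∃ θ : GroupRep Γ 𝔘.Aut,
      (∀ γ ∈ I, ∀ x ∈ C, (repAct θ).act γ x = (repAct π).act γ x) ∧
      HasFiniteHull θ C ∧ ExtendsStage θ p A := by
  classical
  -- The images of `C` under `I` are kept as well, so that the amalgam remembers the values of `π`
  -- that `θ` has to reproduce.
  let Z₀ : Finset 𝔘.Space := C ∪ A ∪ (I ×ˢ C).image fun y => (repAct π).act y.1 y.2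
  have hB : 𝔘.IsUStructure {x // x ∈ p.carrier} :=
    isUStructure_of_embOn 𝔘.isUStructure_space (embOn_subtype_val _)
  obtain ⟨D, strD, finD, hD, d, g, k, hg, hk, hgd, hkd, hkg⟩ :=
    exists_amalgam (⊤ : Subgroup Γ) 𝔘.isUStructure_space hB (repAct π) (p.uact.restrict ⊤)
      {x | x.1 ∈ A} (fun δ x hx => hA δ x hx) Subtype.val
      ((embOn_subtype_val _).mono (Set.subset_univ _)) (fun δ x hx => (hp δ x hx).symm)
      (Subtype.val : {x // x ∈ Z₀} → 𝔘.Space)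
  obtain ⟨θ, u, hu, hug, hud⟩ := exists_rep_lift hD d g Subtype.val hg
  have hCZ : ∀ x ∈ C, x ∈ Z₀ := fun x hx => by simp [Z₀, hx]
  have hAZ : ∀ x ∈ A, x ∈ Z₀ := fun x hx => by simp [Z₀, hx]
  refine ⟨θ, fun γ hγ x hx => ?_, ?_, fun _ _ => ⟨u ∘ k, ?_, fun x hx => ?_, fun γ x => ?_⟩⟩
  · have hy : (repAct π).act γ x ∈ Z₀ :=
      Finset.mem_union_right _ (Finset.mem_image.2
        ⟨(γ, x), Finset.mem_product.2 ⟨hγ, hx⟩, rfl⟩)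
    have := hud γ (g ⟨x, hCZ x hx⟩)
    rwa [← hgd γ ⟨_, hy⟩ ⟨x, hCZ x hx⟩ rfl, hug, hug, eq_comm] at this
  · have := Fintype.ofFinite D
    refine ⟨Finset.univ.image u, fun x hx => Finset.mem_image.2
      ⟨g ⟨x, hCZ x hx⟩, Finset.mem_univ _, hug _⟩, fun γ x hx => ?_⟩
    obtain ⟨y, -, rfl⟩ := Finset.mem_image.1 hx
    rw [← hud]
    exact Finset.mem_image_of_mem u (Finset.mem_univ _)
  · exact (hu.comp k fun _ _ => trivial).trans hk
  · rw [Function.comp_apply, hkg x hx ⟨x.1, hAZ _ hx⟩ rfl, hug]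
  · rw [Function.comp_apply, Function.comp_apply, ← hud]
    exact congrArg u (hkd ⟨γ, trivial⟩ x)

/-- Richness passes to subgroups. -/
lemma Rich.restrict {Γ : Type*} [CommGroup Γ] [Group.FG Γ] {π : GroupRep Γ 𝔘.Aut} (hπ : Rich π)
    (Δ : Subgroup Γ) : Rich (π.restrict Δ) where
  hull A := by
    obtain ⟨A', h, h'⟩ := hπ.hull A
    exact ⟨A', h, fun δ => h' δ⟩
  ext p A hA hp := by
    -- The set `A` is invariant under `Δ` only. Its `Γ`-invariant finite hull `A'` is what the
    -- amalgam retains of `𝐔`, so that the richness of `π` over `Γ` applies to the amalgam over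
    -- `A'`.
    obtain ⟨A', hAA', hA'⟩ := hπ.hull A
    have hB : 𝔘.IsUStructure {x // x ∈ p.carrier} :=
      isUStructure_of_embOn 𝔘.isUStructure_space (embOn_subtype_val _)
    obtain ⟨D, strD, finD, hD, d, g, k, hg, hk, hgd, hkd, hkg⟩ :=
      exists_amalgam Δ 𝔘.isUStructure_space hB (repAct π) p.uact
        {x | x.1 ∈ A} (fun δ x hx => hA δ x hx) Subtype.val
        ((embOn_subtype_val _).mono (Set.subset_univ _)) (fun δ x hx => (hp δ x hx).symm)
        (Subtype.val : {x // x ∈ A'} → 𝔘.Space)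
    obtain ⟨u, hu, hug, hud⟩ := hπ.exists_lift hD d g Subtype.val hg fun γ t =>
      ⟨⟨_, hA' γ t.1 t.2⟩, (hgd γ ⟨_, hA' γ t.1 t.2⟩ t rfl).symm, rfl⟩
    refine ⟨u ∘ k, (hu.comp k fun _ _ => trivial).trans hk, fun x hx => ?_, fun δ x => ?_⟩
    · rw [Function.comp_apply, hkg x hx ⟨x.1, hAA' hx⟩ rfl, hug]
    · exact (congrArg u (hkd δ x)).trans (hud δ (k x))

/-! ### Rich representations are conjugate -/

section BackForth

variable {Γ : Type*} [Group Γ]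

/-- Finite partial isomorphisms between two representations. -/
structure IsPartialIso (π θ : GroupRep Γ 𝔘.Aut) (R : Finset (𝔘.Space × 𝔘.Space)) : Prop where
  same : Same 𝔘 Prod.fst Prod.snd (R : Set (𝔘.Space × 𝔘.Space))
  inv : ∀ γ, ∀ t ∈ R, ((repAct π).act γ t.1, (repAct θ).act γ t.2) ∈ R

open Classical in
lemma IsPartialIso.swap {π θ : GroupRep Γ 𝔘.Aut} {R : Finset (𝔘.Space × 𝔘.Space)}
    (h : IsPartialIso π θ R) : IsPartialIso θ π (R.image Prod.swap) where
  same := by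
    refine (h.same.symm.comp Prod.swap fun t ht => ?_)
    obtain ⟨t', ht', rfl⟩ := Finset.mem_image.1 (Finset.mem_coe.1 ht)
    rwa [Prod.swap_swap]
  inv γ t ht := by
    obtain ⟨t', ht', rfl⟩ := Finset.mem_image.1 ht
    exact Finset.mem_image.2 ⟨_, h.inv γ t' ht', rfl⟩

/-- The forth step: a finite `π`-invariant set containing `x` and the domain of `R` is a finite
structure with an action, and the richness of `θ` embeds it over the range of `R`. The back step is
the same statement for `R.image Prod.swap`. -/
lemma IsPartialIso.exists_extend {π θ : GroupRep Γ 𝔘.Aut} (hπ : Rich π) (hθ : Rich θ)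
    {R : Finset (𝔘.Space × 𝔘.Space)} (h : IsPartialIso π θ R) (x : 𝔘.Space) :
    ∃ R', R ⊆ R' ∧ IsPartialIso π θ R' ∧ ∃ y, (x, y) ∈ R' := by
  classical
  obtain ⟨A, hA, hinv⟩ := hπ.hull (insert x (R.image Prod.fst))
  have hx : x ∈ A := hA (Finset.mem_insert_self _ _)
  have hR : ∀ t ∈ R, t.1 ∈ A := fun t ht =>
    hA (Finset.mem_insert_of_mem (Finset.mem_image_of_mem _ ht))
  have hC : 𝔘.IsUStructure {x // x ∈ A} :=
    isUStructure_of_embOn 𝔘.isUStructure_space (embOn_subtype_val _)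
  obtain ⟨u, hu, huf, hua⟩ := hθ.exists_lift hC
    ((repAct π).onSubtype (· ∈ A) fun γ x hx => hinv γ x hx)
    (fun t : {t // t ∈ R} => (⟨t.1.1, hR t.1 t.2⟩ : {x // x ∈ A})) (fun t => t.1.2)
    (((embOn_subtype_val _).symm.comp
      (fun t : {t // t ∈ R} => (⟨t.1.1, hR t.1 t.2⟩ : {x // x ∈ A}))
        (B := Set.univ) fun _ _ => trivial).trans (h.same.comp Subtype.val fun t _ => t.2))
    fun γ t => ⟨⟨_, h.inv γ t.1 t.2⟩, rfl, rfl⟩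
  refine ⟨A.attach.image fun a => (a.1, u a), fun t ht => ?_, ⟨?_, ?_⟩, u ⟨x, hx⟩, ?_⟩
  · exact Finset.mem_image.2 ⟨⟨t.1, hR t ht⟩, Finset.mem_attach _ _,
      Prod.ext rfl (huf ⟨t, ht⟩)⟩
  · let σ : 𝔘.Space × 𝔘.Space → {x // x ∈ A} := fun t =>
      if h : t.1 ∈ A then ⟨t.1, h⟩ else ⟨x, hx⟩
    have hσ : ∀ a : {x // x ∈ A}, σ (a.1, u a) = a := fun a => by simp [σ]
    refine (((embOn_subtype_val _).trans hu.symm).comp σ fun _ _ => trivial).congr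
      (fun t ht => ?_) fun t ht => ?_ <;>
    obtain ⟨a, -, rfl⟩ := Finset.mem_image.1 (Finset.mem_coe.1 ht) <;>
    simp only [Function.comp_apply, hσ]
  · intro γ t ht
    obtain ⟨a, -, rfl⟩ := Finset.mem_image.1 ht
    exact Finset.mem_image.2 ⟨⟨_, hinv γ a.1 a.2⟩, Finset.mem_attach _ _,
      Prod.ext rfl (hua γ a)⟩
  · exact Finset.mem_image.2 ⟨⟨x, hx⟩, Finset.mem_attach _ _, rfl⟩

lemma Rich.mem_orbit {π θ : GroupRep Γ 𝔘.Aut} (hπ : Rich π) (hθ : Rich θ) : θ ∈ π.orbit := by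
  classical
  have := Encodable.ofCountable 𝔘.Space
  let P := {R // IsPartialIso π θ R}
  let 𝒟 : 𝔘.Space ⊕ 𝔘.Space → Order.Cofinal P := fun x => match x with
    | .inl x => ⟨{R | ∃ y, (x, y) ∈ R.1}, fun R => by
        obtain ⟨R', h1, h2, h3⟩ := R.2.exists_extend hπ hθ x
        exact ⟨⟨R', h2⟩, h3, h1⟩⟩
    | .inr y => ⟨{R | ∃ x, (x, y) ∈ R.1}, fun R => by
        obtain ⟨R', h1, h2, x, h3⟩ := R.2.swap.exists_extend hθ hπ y
        refine ⟨⟨_, h2.swap⟩, ⟨x, Finset.mem_image.2 ⟨_, h3, rfl⟩⟩, fun t ht => ?_⟩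
        exact Finset.mem_image.2 ⟨t.swap, h1 (Finset.mem_image_of_mem _ ht), Prod.swap_swap t⟩⟩
  let s := Order.sequenceOfCofinals
    -- The empty map is a partial isomorphism because there are no symbols of arity `0`.
    (⟨∅, ⟨fun _ h => by simp at h, fun _ _ h => by simp at h,
        fun i v hv => absurd (hv ⟨0, 𝔘.arity_pos i⟩) (by simp)⟩,
      fun _ _ h => by simp at h⟩ : P) 𝒟
  have hs : Monotone s := Order.sequenceOfCofinals.monotone _ 𝒟
  have hsub : ∀ m n, m ≤ n → (s m).1 ⊆ (s n).1 := fun m n h => hs h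
  have hfwd : ∀ x, ∃ y n, (x, y) ∈ (s n).1 := fun x => by
    obtain ⟨y, hy⟩ := Order.sequenceOfCofinals.encode_mem _ 𝒟 (.inl x)
    exact ⟨y, _, hy⟩
  have hbwd : ∀ y, ∃ x n, (x, y) ∈ (s n).1 := fun y => by
    obtain ⟨x, hx⟩ := Order.sequenceOfCofinals.encode_mem _ 𝒟 (.inr y)
    exact ⟨x, _, hx⟩
  choose g N hg using hfwd
  have huniq : ∀ x y n, (x, y) ∈ (s n).1 → g x = y := fun x y n h => by
    have h1 := hsub _ _ (le_max_left n (N x)) h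
    have h2 := hsub _ _ (le_max_right n (N x)) (hg x)
    exact ((s (max n (N x))).2.same.eq _ h2 _ h1).1 rfl
  have hsame : EmbOn 𝔘 g Set.univ := by
    refine ⟨fun x _ y _ => ?_, fun t x _ y _ => ?_, fun i v _ => ?_⟩
    · have h1 := hsub _ _ (le_max_left (N x) (N y)) (hg x)
      have h2 := hsub _ _ (le_max_right (N x) (N y)) (hg y)
      exact ((s _).2.same.eq _ h1 _ h2).symm
    · have h1 := hsub _ _ (le_max_left (N x) (N y)) (hg x)
      have h2 := hsub _ _ (le_max_right (N x) (N y)) (hg y)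
      exact ((s _).2.same.relE t _ h1 _ h2).symm
    · have h1 : ∀ j, (v j, g (v j)) ∈ (s (Finset.univ.sup fun j => N (v j))).1 := fun j =>
        hsub _ _ (Finset.le_sup (f := fun j => N (v j)) (Finset.mem_univ j)) (hg (v j))
      exact ((s _).2.same.relP i (fun j => (v j, g (v j))) h1).symm
  have hsurj : Function.Surjective g := fun y => by
    obtain ⟨x, n, h⟩ := hbwd y
    exact ⟨x, huniq _ _ _ h⟩
  have hequiv : ∀ γ x, g ((repAct π).act γ x) = (repAct θ).act γ (g x) := fun γ x =>
    huniq _ _ _ ((s (N x)).2.inv γ _ (hg x))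
  let G : 𝔘.Aut :=
    { Equiv.ofBijective g ⟨fun x y h => (hsame.eq x trivial y trivial).1 h, hsurj⟩ with
      map_fun' := fun {_} F => Empty.elim F
      map_rel' := hsame.toEmbedding.map_rel' : 𝔘.Space ≃[𝔘.lang] 𝔘.Space }
  refine ⟨G, fun γ => ?_⟩
  rw [mul_inv_eq_iff_eq_mul]
  exact aut_ext fun x => hequiv γ x

end BackForth

/-- An induction principle for finitely generated groups. -/
lemma exists_finset_generating (Γ : Type*) [Group Γ] [Group.FG Γ] :
    ∃ S : Finset Γ, ∀ p : Γ → Prop, p 1 → (∀ γ δ, p γ → p δ → p (γ * δ)) → (∀ γ ∈ S, p γ) →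
      ∀ γ, p γ := by
  -- Generation as a monoid makes a closure condition under inverses unnecessary.
  obtain ⟨S, hS⟩ := Monoid.fg_def.1 (inferInstance : Monoid.FG Γ)
  refine ⟨S, fun p h1 hmul hp γ => ?_⟩
  have hγ : γ ∈ Submonoid.closure (S : Set Γ) := hS ▸ Submonoid.mem_top γ
  induction hγ using Submonoid.closure_induction with
  | mem γ h => exact hp γ h
  | one => exact h1
  | mul γ δ _ _ h h' => exact hmul γ δ h h'

lemma countable_of_group_fg (Γ : Type*) [Group Γ] [Group.FG Γ] : Countable Γ := by
  obtain ⟨S, hS⟩ := exists_finset_generating Γ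
  refine Function.Surjective.countable (f := fun l : List {γ // γ ∈ S} => (l.map Subtype.val).prod)
    (hS _ ⟨[], rfl⟩ ?_ fun γ hγ => ⟨[⟨γ, hγ⟩], by simp⟩)
  rintro _ _ ⟨l, rfl⟩ ⟨l', rfl⟩
  exact ⟨l ++ l', by simp⟩

/-- An action on a finite set is determined by the action of finitely many generators. -/
instance countable_stage {Γ : Type*} [Group Γ] [Group.FG Γ] : Countable (Stage 𝔘 Γ) := by
  obtain ⟨S, hS⟩ := exists_finset_generating Γ
  refine Function.Injective.countable (β := Σ B : Finset 𝔘.Space,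
    ({γ // γ ∈ S} → {x // x ∈ B} → {x // x ∈ B}))
    (f := fun p => ⟨p.carrier, fun γ x => p.uact.act γ x⟩) ?_
  rintro ⟨B, b⟩ ⟨B', b'⟩ h
  obtain ⟨rfl, h⟩ := Sigma.mk.inj_iff.1 h
  have h' := eq_of_heq h
  have key : ∀ γ, b.act γ = b'.act γ := by
    refine hS _ (funext fun x => (b.one x).trans (b'.one x).symm) (fun γ δ hγ hδ => ?_)
      fun γ hγ => congrFun h' ⟨γ, hγ⟩
    funext x
    rw [b.mul, b'.mul, hγ, hδ]
  obtain ⟨act, _, _, _⟩ := b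
  obtain ⟨act', _, _, _⟩ := b'
  obtain rfl : act = act' := funext key
  rfl

/-! ### The space of representations -/

/-- `𝐔` carries the discrete topology. -/
instance : TopologicalSpace 𝔘.Space := ⊥

instance : DiscreteTopology 𝔘.Space := ⟨rfl⟩

section Topology

variable {Γ : Type*} [Group Γ]

lemma isInducing_repAct :
    Topology.IsInducing fun (π : GroupRep Γ 𝔘.Aut) (γ : Γ) => (repAct π).act γ := by
  have h1 : Topology.IsInducing (GroupRep.eval : GroupRep Γ 𝔘.Aut → Γ → 𝔘.Aut) := ⟨rfl⟩
  have h2 : Topology.IsInducing (fun (g : 𝔘.Aut) (x : 𝔘.Space) => g x) := ⟨rfl⟩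
  exact (Topology.IsInducing.piMap fun _ : Γ => h2).comp h1

lemma isOpen_rep_iff (V : Set (GroupRep Γ 𝔘.Aut)) :
    IsOpen V ↔ ∀ π ∈ V, ∃ (I : Finset Γ) (C : Finset 𝔘.Space), ∀ θ : GroupRep Γ 𝔘.Aut,
      (∀ γ ∈ I, ∀ x ∈ C, (repAct θ).act γ x = (repAct π).act γ x) → θ ∈ V := by
  classical
  constructor
  · rintro hV π hπ
    obtain ⟨W, hW, rfl⟩ := isInducing_repAct.isOpen_iff.1 hV
    obtain ⟨I, u, hu, hIu⟩ := isOpen_pi_iff.1 hW _ hπ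
    have : ∀ γ ∈ I, ∃ C : Finset 𝔘.Space, ∀ f : 𝔘.Space → 𝔘.Space,
        (∀ x ∈ C, f x = (repAct π).act γ x) → f ∈ u γ := fun γ hγ => by
      obtain ⟨C, v, hv, hCv⟩ := isOpen_pi_iff.1 (hu γ hγ).1 _ (hu γ hγ).2
      exact ⟨C, fun f hf => hCv fun x hx => by rw [hf x hx]; exact (hv x hx).2⟩
    choose! C hC using this
    refine ⟨I, I.biUnion C, fun θ hθ => hIu fun γ hγ => hC γ hγ _ fun x hx => ?_⟩
    exact hθ γ hγ x (Finset.mem_biUnion.2 ⟨γ, hγ, hx⟩)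
  · intro h
    refine isOpen_iff_mem_nhds.2 fun π hπ => ?_
    obtain ⟨I, C, H⟩ := h π hπ
    refine Filter.mem_of_superset (x := ⋂ γ ∈ I, ⋂ x ∈ C,
      {θ | (repAct θ).act γ x = (repAct π).act γ x}) ?_ fun θ hθ => H θ ?_
    · refine (Filter.biInter_finset_mem I).2 fun γ _ => (Filter.biInter_finset_mem C).2 fun x _ => ?_
      refine IsOpen.mem_nhds ?_ rfl
      have hc : Continuous fun θ : GroupRep Γ 𝔘.Aut => (repAct θ).act γ x :=
        (continuous_apply x).comp ((continuous_apply γ).comp isInducing_repAct.continuous)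
      exact (isOpen_discrete {(repAct π).act γ x}).preimage hc
    · simpa using hθ

/-- Being a homomorphism into the automorphisms is a conjunction of conditions on finitely many
values at a time. Surjectivity, which is not such a condition, comes for free, since `γ⁻¹` provides
the inverse map. -/
lemma isClosedEmbedding_repAct :
    Topology.IsClosedEmbedding fun (π : GroupRep Γ 𝔘.Aut) (γ : Γ) => (repAct π).act γ := by
  refine ⟨⟨isInducing_repAct, fun π θ h => rep_ext fun γ x => congrFun (congrFun h γ) x⟩, ?_⟩
  have hc : ∀ (γ : Γ) (x : 𝔘.Space), Continuous fun f : Γ → 𝔘.Space → 𝔘.Space => f γ x :=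
    fun γ x => (continuous_apply x).comp (continuous_apply γ)
  have hcl : ∀ (γ : Γ) (x : 𝔘.Space) (A : Set 𝔘.Space),
      IsClosed {f : Γ → 𝔘.Space → 𝔘.Space | f γ x ∈ A} := fun γ x A =>
    (isClosed_discrete A).preimage (hc γ x)
  have hcl₂ : ∀ (γ δ : Γ) (x y : 𝔘.Space) (A : Set (𝔘.Space × 𝔘.Space)),
      IsClosed {f : Γ → 𝔘.Space → 𝔘.Space | (f γ x, f δ y) ∈ A} := fun γ δ x y A =>
    (isClosed_discrete A).preimage ((hc γ x).prodMk (hc δ y))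
  have hrange : (Set.range fun (π : GroupRep Γ 𝔘.Aut) (γ : Γ) => (repAct π).act γ) =
      (⋂ x, {f | f 1 x ∈ ({x} : Set 𝔘.Space)}) ∩
      -- The composite `f γ (f δ x)` is handled by fixing the intermediate point `y`.
      (⋂ γ, ⋂ δ, ⋂ x, ⋂ y, ({f | f δ x ∈ {z | z ≠ y}} ∪
        {f | (f (γ * δ) x, f γ y) ∈ {t | t.1 = t.2}})) ∩
      (⋂ γ, ⋂ x, ⋂ y, {f | (f γ x, f γ y) ∈ {t | t.1 = t.2 ↔ x = y}}) ∩
      (⋂ γ, ⋂ s, ⋂ x, ⋂ y, {f | (f γ x, f γ y) ∈ {t | 𝔘.relE s t.1 t.2 ↔ 𝔘.relE s x y}}) ∩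
      ⋂ γ, ⋂ i, ⋂ v : Fin (𝔘.arity i) → 𝔘.Space,
        {f | (fun j => f γ (v j)) ∈ {w | 𝔘.relP i w ↔ 𝔘.relP i v}} := by
    ext f
    simp only [Set.mem_range, Set.mem_inter_iff, Set.mem_iInter, Set.mem_union,
      Set.mem_ofPred_eq, Set.mem_singleton_iff]
    constructor
    · rintro ⟨π, rfl⟩
      refine ⟨⟨⟨⟨(repAct π).one, fun γ δ x y => ?_⟩, fun γ x y => (repAct π).inj γ⟩,
        fun γ s x y => (repAct π).relE_act γ s x y⟩, fun γ i v => (repAct π).relP_act γ i v⟩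
      by_cases h : (repAct π).act δ x = y
      · exact Or.inr (h ▸ (repAct π).mul γ δ x)
      · exact Or.inl h
    · rintro ⟨⟨⟨⟨h1, h2⟩, h3⟩, h4⟩, h5⟩
      let a : UAct 𝔘 Γ 𝔘.Space := ⟨f, h1, fun γ δ x => (h2 γ δ x (f δ x)).resolve_left fun h => h rfl,
        fun γ => ⟨fun x _ y _ => h3 γ x y, fun s x _ y _ => h4 γ s x y, fun i v _ => h5 γ i v⟩⟩
      exact ⟨a.toRep, rfl⟩
  rw [hrange]
  refine (((?_ : IsClosed _).inter ?_).inter ?_).inter ?_ |>.inter ?_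
  · exact isClosed_iInter fun x => hcl _ _ _
  · exact isClosed_iInter fun γ => isClosed_iInter fun δ => isClosed_iInter fun x =>
      isClosed_iInter fun y => (hcl _ _ _).union (hcl₂ _ _ _ _ _)
  · exact isClosed_iInter fun γ => isClosed_iInter fun x => isClosed_iInter fun y => hcl₂ _ _ _ _ _
  · exact isClosed_iInter fun γ => isClosed_iInter fun s => isClosed_iInter fun x =>
      isClosed_iInter fun y => hcl₂ _ _ _ _ _
  · exact isClosed_iInter fun γ => isClosed_iInter fun i => isClosed_iInter fun v =>
      (isClosed_discrete _).preimage (continuous_pi fun j => hc γ (v j))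

lemma baireSpace_rep [Countable Γ] : BaireSpace (GroupRep Γ 𝔘.Aut) := by
  have : PolishSpace 𝔘.Space := inferInstance
  have : PolishSpace (GroupRep Γ 𝔘.Aut) := isClosedEmbedding_repAct.polishSpace
  infer_instance

/-- Invariance of a finite set involves only the values of finitely many generators on that set. -/
lemma isOpen_hasFiniteHull [Group.FG Γ] (A : Finset 𝔘.Space) :
    IsOpen {π : GroupRep Γ 𝔘.Aut | HasFiniteHull π A} := by
  obtain ⟨S, hS⟩ := exists_finset_generating Γ
  refine (isOpen_rep_iff _).2 fun π ⟨A', h, h'⟩ => ⟨S, A', fun θ hθ => ⟨A', h, ?_⟩⟩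
  refine hS _ (fun x hx => ?_) (fun γ δ hγ hδ x hx => ?_) fun γ hγ x hx => ?_
  · rwa [(repAct θ).one]
  · rw [(repAct θ).mul]
    exact hγ _ (hδ x hx)
  · rw [hθ γ hγ x hx]
    exact h' γ x hx

/-- A solution `k` for `π` remains one for every `θ` that agrees with `π` at the generators on the
range of `k`. If the actions of `π` and `p` disagree at a point of `A`, so do those of `θ` and `p`
for all `θ` near `π`, and nothing is required. -/
lemma isOpen_extendsStage [Group.FG Γ] (p : Stage 𝔘 Γ) (A : Finset 𝔘.Space) :
    IsOpen {π : GroupRep Γ 𝔘.Aut | ExtendsStage π p A} := by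
  classical
  obtain ⟨S, hS⟩ := exists_finset_generating Γ
  refine (isOpen_rep_iff _).2 fun π hπ => ?_
  by_cases hA : ∀ γ x, x.1 ∈ A → (p.uact.act γ x).1 ∈ A
  swap
  · exact ⟨∅, ∅, fun θ _ h => absurd h hA⟩
  by_cases hp : ∀ γ x, x.1 ∈ A → (repAct π).act γ x.1 = (p.uact.act γ x).1
  · obtain ⟨k, hk, hkA, hka⟩ := hπ hA hp
    refine ⟨S, Finset.univ.image k, fun θ hθ _ _ => ⟨k, hk, hkA, ?_⟩⟩
    refine hS _ (fun x => ?_) (fun γ δ hγ hδ x => ?_) fun γ hγ x => ?_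
    · rw [p.uact.one, (repAct θ).one]
    · rw [p.uact.mul, (repAct θ).mul, hγ, hδ]
    · rw [hθ γ hγ _ (Finset.mem_image_of_mem k (Finset.mem_univ x)), hka]
  · push Not at hp
    obtain ⟨γ, x, hx, hne⟩ := hp
    refine ⟨{γ}, {x.1}, fun θ hθ _ h => absurd (h γ x hx) ?_⟩
    rwa [hθ γ (Finset.mem_singleton_self _) _ (Finset.mem_singleton_self _)]

end Topology

/-! ### Rich representations are comeagre, hence generic. -/

section Residual

variable {Γ : Type*} [CommGroup Γ] [Group.FG Γ]

lemma dense_hasFiniteHull (A : Finset 𝔘.Space) :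
    Dense {π : GroupRep Γ 𝔘.Aut | HasFiniteHull π A} := by
  classical
  refine dense_iff_inter_open.2 fun V hV ⟨π, hπ⟩ => ?_
  obtain ⟨I, C, H⟩ := (isOpen_rep_iff V).1 hV π hπ
  obtain ⟨θ, h1, ⟨A', h2, h3⟩, -⟩ := exists_rep_approx π I (C ∪ A)
    ⟨∅, UAct.trivialAct 𝔘 _ Γ⟩ ∅ (fun _ _ hx => absurd hx (Finset.notMem_empty _))
    fun _ _ hx => absurd hx (Finset.notMem_empty _)
  exact ⟨θ, H θ fun γ hγ x hx => h1 γ hγ x (Finset.mem_union_left _ hx),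
    A', Finset.union_subset_right h2, h3⟩

/-- A representation without the property satisfies the premises of `ExtendsStage`, and then
`exists_rep_approx` applies to it. -/
lemma dense_extendsStage (p : Stage 𝔘 Γ) (A : Finset 𝔘.Space) :
    Dense {π : GroupRep Γ 𝔘.Aut | ExtendsStage π p A} := by
  refine dense_iff_inter_open.2 fun V hV ⟨π, hπ⟩ => ?_
  by_cases hext : ExtendsStage π p A
  · exact ⟨π, hπ, hext⟩
  obtain ⟨I, C, H⟩ := (isOpen_rep_iff V).1 hV π hπ
  have hA : ∀ γ x, x.1 ∈ A → (p.uact.act γ x).1 ∈ A := by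
    by_contra h
    exact hext fun h' => absurd h' h
  have hp : ∀ γ x, x.1 ∈ A → (repAct π).act γ x.1 = (p.uact.act γ x).1 := by
    by_contra h
    exact hext fun _ h' => absurd h' h
  obtain ⟨θ, h1, -, h2⟩ := exists_rep_approx π I C p A hA hp
  exact ⟨θ, H θ h1, h2⟩

/-- There are only countably many stages and finite subsets of `𝐔`, so richness is a countable
intersection of dense open conditions. -/
lemma rich_mem_residual : {π : GroupRep Γ 𝔘.Aut | Rich π} ∈ residual (GroupRep Γ 𝔘.Aut) := by
  have h1 : (⋂ A, {π : GroupRep Γ 𝔘.Aut | HasFiniteHull π A}) ∈ residual (GroupRep Γ 𝔘.Aut) :=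
    countable_iInter_mem.2 fun A =>
      residual_of_dense_open (isOpen_hasFiniteHull A) (dense_hasFiniteHull A)
  have h2 : (⋂ p, ⋂ A, {π : GroupRep Γ 𝔘.Aut | ExtendsStage π p A}) ∈
      residual (GroupRep Γ 𝔘.Aut) :=
    countable_iInter_mem.2 fun p => countable_iInter_mem.2 fun A =>
      residual_of_dense_open (isOpen_extendsStage p A) (dense_extendsStage p A)
  filter_upwards [h1, h2] with π hπ hπ'
  simp only [Set.mem_iInter, Set.mem_ofPred_eq] at hπ hπ'
  exact ⟨hπ, hπ'⟩

lemma Rich.isGeneric {π : GroupRep Γ 𝔘.Aut} (hπ : Rich π) : π.IsGeneric :=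
  Filter.mem_of_superset rich_mem_residual fun _ hθ => hπ.mem_orbit hθ

variable (𝔘 Γ) in
lemma exists_rich : ∃ π : GroupRep Γ 𝔘.Aut, Rich π := by
  have := countable_of_group_fg Γ
  have : BaireSpace (GroupRep Γ 𝔘.Aut) := baireSpace_rep
  have : Nonempty (GroupRep Γ 𝔘.Aut) := ⟨(UAct.trivialAct 𝔘 𝔘.Space Γ).toRep⟩
  exact (dense_of_mem_residual rich_mem_residual).nonempty

end Residual

end UTuple

theorem mainTheorem10 (𝔘 : UTuple) {Γ : Type*} [CommGroup Γ] (Δ Λ : Subgroup Γ)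
    (hΔ : Δ.FG) (hΛ : Λ.FG) (hΓ : Δ ⊔ Λ = ⊤) :
    ∃ π : GroupRep Γ 𝔘.Aut, π.IsGeneric ∧ (π.restrict Δ).IsGeneric := by
  have : Group.FG Γ := Group.fg_def.2 (hΓ ▸ hΔ.sup hΛ)
  have : Group.FG Δ := (Group.fg_iff_subgroup_fg Δ).2 hΔ
  obtain ⟨π, hπ⟩ := UTuple.exists_rich 𝔘 Γ
  exact ⟨π, hπ.isGeneric, (hπ.restrict Δ).isGeneric⟩
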